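/- **Setting.** Totally order $\mathbb N\sqcup\overline{\mathbb N}$ by $0\prec\overline 0\prec 1\prec\overline 1\prec 2\prec\cdots$, so that $i\prec\overline j$ iff $i\le j$. Let $I\subset\mathbb N$ and $\overline J\subset\overline{\mathbb N}$ be nonempty finite sets with $\min(I\sqcup\overline J)\in I$ and $\max(I\sqcup\overline J)\in\overline J$. Let $\mathsf h$ be a non-crossing height function, i.e. a real function on the pairs $(i,\overline j)\in I\times\overline J$ with $i\prec\overline j$ such that $$\mathsf h(i,\overline{j'})+\mathsf h(i',\overline j)<\mathsf h(i,\overline j)+\mathsf h(i',\overline{j'})\quad\text{whenever } i\prec i'\prec\overline j\prec\overline{j'},$$ extended by $\mathsf h(i,\overline j)=\infty$ for $i\succ\overline j$. For $i\in I$ let $H_i$ be the inverted tropical hyperplane of the points $x$ for which $\max_{\overline j\in\overline J}\{x_{\overline j}-\mathsf h(i,\overline j)\}$ is attained at least twice; it divides $\mathbb R^{\overline J}$ into the closed regions on which the maximum is attained at a given $\overline j$. The cells of the arrangement $(H_i)_{i\in I}$ are the nonempty intersections of such regions with at least one region from each $H_i$, intersected with $\{x_{\max\overline J}=0\}$. The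 $(I,\overline J)$-associahedron $\operatorname{Asso}_{I,\overline J}(\mathsf h)$ is the collection of the bounded cells, and its support is their union. Let $\nu(I,\overline J)$ be the lattice path obtained by listing $I\sqcup\overline J$ increasingly, discarding the first and the last element, and reading an east step $\mathsf E$ for each element of $I$ and a north step $\mathsf N$ for each element of $\overline J$. A north step of a lattice path is *initial* if no east step precedes it. For a lattice path $\nu$, the $\nu$-associahedron $\operatorname{Asso}_\nu(\mathsf h)$ is $\operatorname{Asso}_{I,\overline J}(\mathsf h)$ for any $(I,\overline J)$ with $\nu(I,\overline J)=\nu$. A *regular polyhedral subdivision* of a polytope $P$ is a polyhedral subdivision of $P$ whose cells are the projections of the lower faces of the convex hull of a lifting of a finite point set with convex hull $P$. A *classical associahedron of dimension $d$* is a $d$-dimensional polytope whose poset of nonempty faces is anti-isomorphic to the poset of dissections of a convex $(d+3)$-gon by pairwise non-crossing diagonals, ordered by inclusion. **Theorem.** 1. Put $\overline J'=\{\overline j\in\overline J:\exists\, i_1,i_2\in I,\ i_1\prec i_2\prec\overline j\}$. The support of $\operatorname{Asso}_{I,\overline J}(\mathsf h)$ is convex if and only if $I\sqcup\overline J'\setminus\{\max\overline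 J\}$ has no two consecutive elements that both belong to $\overline J$; equivalently, if and only if $\nu(I,\overline J)$ does not have two consecutive non-initial north steps. In this case $\operatorname{Asso}_{I,\overline J}(\mathsf h)$ is a regular polyhedral subdivision of its support, which is a classical associahedron of dimension $|\overline J'\setminus\{\max\overline J\}|$ (this is $|\overline J'|-1$ if $|I|\ge2$, and $0$ if $|I|=1$). 2. Every lattice path $\nu$ is of the form $\nu(I,\overline J)$. The support of $\operatorname{Asso}_\nu(\mathsf h)$ is convex if and only if $\nu$ does not have two consecutive non-initial north steps, and in this case $\operatorname{Asso}_\nu(\mathsf h)$ is a regular polyhedral subdivision of its support, which is a classical associahedron of dimension equal to the number of non-initial north steps of $\nu$. 3. In particular, for $m,n\ge1$ and $\nu=(\mathsf N\mathsf E^m)^n$, the support of the $m$-associahedron $\operatorname{Asso}_\nu(\mathsf h)$ is convex, and the $m$-associahedron is a regular polyhedral subdivision of its support, which is a classical associahedron of dimension $n-1$. -/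

import Mathlib

namespace NuAsso

/-! ### Polytopes, regular subdivisions, associahedra -/

section Polytopes

variable {E : Type*} [TopologicalSpace E] [AddCommGroup E] [Module ℝ E]

/-- A (nonempty) convex polytope: the convex hull of a nonempty finite set of points. -/
def IsPolytope (P : Set E) : Prop :=
  ∃ s : Finset E, s.Nonempty ∧ P = convexHull ℝ (s : Set E)

/-- `𝒞` is a polyhedral subdivision of `P`: a finite collection of nonempty polytopes, closed
under passing to nonempty faces, any two of which meet in a common (possibly empty) face, and
whose union is `P`. -/
def IsPolyhedralSubdivision (𝒞 : Set (Set E)) (P : Set E) : Prop :=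
  𝒞.Finite ∧
  (∀ C ∈ 𝒞, IsPolytope C) ∧
  (∀ C ∈ 𝒞, ∀ F : Set E, F.Nonempty → IsExposed ℝ C F → F ∈ 𝒞) ∧
  (∀ C ∈ 𝒞, ∀ D ∈ 𝒞, (C ∩ D).Nonempty → IsExposed ℝ C (C ∩ D) ∧ IsExposed ℝ D (C ∩ D)) ∧
  ⋃₀ 𝒞 = P

/-- `𝒞` is a regular polyhedral subdivision of `P`: it is a polyhedral subdivision, and for a
finite point set `A` with convex hull `P` and some heights `w`, the cells in `𝒞` are exactly the
projections of the lower faces of the convex hull of the lifted points `(v, w v)`, `v ∈ A`. -/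
def IsRegularSubdivision (𝒞 : Set (Set E)) (P : Set E) : Prop :=
  IsPolyhedralSubdivision 𝒞 P ∧
  ∃ (A : Finset E) (w : E → ℝ), A.Nonempty ∧ convexHull ℝ (A : Set E) = P ∧
    𝒞 = {C | ∃ a : E →ₗ[ℝ] ℝ,
      C = convexHull ℝ {v | v ∈ A ∧ ∀ u ∈ A, a v + w v ≤ a u + w u}}

/-- `(a, b)` is a diagonal of the convex `n`-gon with vertices `0, …, n - 1` in cyclic order. -/
def IsDiagonal {n : ℕ} (e : Fin n × Fin n) : Prop :=
  (e.1 : ℕ) + 2 ≤ e.2 ∧ ¬((e.1 : ℕ) = 0 ∧ (e.2 : ℕ) + 1 = n)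

/-- The diagonals `(a, b)` and `(c, d)` (with `a < b`, `c < d`) cross in the interior of the
polygon, with `a < c`. -/
def DiagonalsCross {n : ℕ} (e f : Fin n × Fin n) : Prop :=
  e.1 < f.1 ∧ f.1 < e.2 ∧ e.2 < f.2

/-- Dissections of the convex `n`-gon: sets of pairwise non-crossing diagonals, ordered by
inclusion. -/
abbrev Dissection (n : ℕ) : Type :=
  {D : Finset (Fin n × Fin n) // (∀ e ∈ D, IsDiagonal e) ∧ ∀ e ∈ D, ∀ f ∈ D, ¬DiagonalsCross e f}

/-- `P` is a classical `d`-dimensional associahedron: a `d`-dimensional polytope whose poset of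
nonempty faces is anti-isomorphic to the poset of dissections of a convex `(d + 3)`-gon. -/
def IsAssociahedron (d : ℕ) (P : Set E) : Prop :=
  IsPolytope P ∧
  Module.finrank ℝ (vectorSpan ℝ P) = d ∧
  Nonempty ({F : Set E // F.Nonempty ∧ IsExposed ℝ P F} ≃o (Dissection (d + 3))ᵒᵈ)

end Polytopes

/-! ### Nodes and pairs `(I, J̄)` -/

/-- The totally ordered set `ℕ ⊔ ℕ̄`, with `0 ≺ 0̄ ≺ 1 ≺ 1̄ ≺ 2 ≺ ⋯`. -/
abbrev Node : Type := ℕ ×ₗ Bool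

/-- The node `i ∈ ℕ`. -/
def plain (i : ℕ) : Node := toLex (i, false)

/-- The node `j̄ ∈ ℕ̄`. -/
def bar (j : ℕ) : Node := toLex (j, true)

/-- `i ≺ j̄` if and only if `i ≤ j`. -/
theorem plain_lt_bar (i j : ℕ) : plain i < bar j ↔ i ≤ j := by
  simp [plain, bar, Prod.Lex.toLex_lt_toLex, le_iff_lt_or_eq]

/-- `j̄ ≺ i` if and only if `j < i`. -/
theorem bar_lt_plain (i j : ℕ) : bar j < plain i ↔ j < i := by
  simp [plain, bar, Prod.Lex.toLex_lt_toLex]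

/-- A pair of nonempty finite sets `I ⊆ ℕ` and `J̄ ⊆ ℕ̄` with `min (I ⊔ J̄) ∈ I` and
`max (I ⊔ J̄) ∈ J̄`. -/
structure IJPair where
  I : Finset ℕ
  J : Finset ℕ
  hI : I.Nonempty
  hJ : J.Nonempty
  min_le : I.min' hI ≤ J.min' hJ
  max_le : I.max' hI ≤ J.max' hJ

/-- The steps of a lattice path: north and east unit steps. -/
inductive Step : Type
  | N
  | E
  deriving DecidableEq

/-- A lattice path has two consecutive non-initial north steps; a north step is initial if no
east step precedes it. -/
def HasNonInitialNN (ν : List Step) : Prop :=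
  ∃ α β : List Step, ν = α ++ Step.N :: Step.N :: β ∧ Step.E ∈ α

/-- The number of non-initial north steps of a lattice path. -/
def nonInitialNorth (ν : List Step) : ℕ :=
  (ν.dropWhile (fun s => decide (s = Step.N))).count Step.N

/-- The lattice path `(N E^m)^n`. -/
def fussCatalanPath (m n : ℕ) : List Step :=
  (List.replicate n (Step.N :: List.replicate m Step.E)).flatten

namespace IJPair

/-- `max J̄`. -/
def jmax (P : IJPair) : P.J := ⟨P.J.max' P.hJ, P.J.max'_mem P.hJ⟩

/-- The set of nodes `A ⊔ B̄`. -/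
def nodes (A B : Finset ℕ) : Finset Node := A.image plain ∪ B.image bar

/-- `J̄' = {j̄ ∈ J̄ : ∃ i₁ ≺ i₂ ≺ j̄}`. -/
def J' (P : IJPair) : Finset ℕ :=
  P.J.filter (fun j => ∃ i₁ ∈ P.I, ∃ i₂ ∈ P.I, i₁ < i₂ ∧ i₂ ≤ j)

/-- `J̄' ∖ {max J̄}`. -/
def innerJ (P : IJPair) : Finset ℕ := P.J'.erase (P.jmax : ℕ)

/-- The totally ordered set `I ⊔ J̄' ∖ {max J̄}` contains two consecutive elements that both belong
to `J̄`. -/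
def HasConsecutiveBars (P : IJPair) : Prop :=
  ∃ j₁ j₂ : ℕ, bar j₁ ∈ nodes P.I P.innerJ ∧ bar j₂ ∈ nodes P.I P.innerJ ∧ bar j₁ < bar j₂ ∧
    ∀ v ∈ nodes P.I P.innerJ, ¬(bar j₁ < v ∧ v < bar j₂)

/-- The lattice path `ν(I, J̄)`: list the elements of `I ⊔ J̄` in increasing order, discard the
first and the last one, and read an east step for each element of `I` and a north step for each
element of `J̄`. -/
def path (P : IJPair) : List Step :=
  ((nodes P.I P.J).sort (· ≤ ·)).tail.dropLast.map
    (fun v => if (ofLex v).2 then Step.N else Step.E)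

/-! ### The `(I, J̄)`-associahedron -/

/-- Non-crossing height functions: only the values `h i j` with `i ≺ j̄` matter here and below;
the remaining ones are considered to be `∞`. -/
def NonCrossing (P : IJPair) (h : P.I → P.J → ℝ) : Prop :=
  ∀ (i i' : P.I) (j j' : P.J), (i : ℕ) < i' → (i' : ℕ) ≤ j → (j : ℕ) < j' →
    h i j' + h i' j < h i j + h i' j'

/-- The closed region of `ℝ^J̄` cut out by the inverted tropical hyperplane `H_i` on which
`max_k (-h(i,k̄) + x_k̄)` is attained at `j̄`. As `h(i,k̄) = ∞` for `k̄ ≺ i`, such `k̄` do not contribute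
to the maximum, and the region is empty unless `i ≺ j̄`. -/
def region (P : IJPair) (h : P.I → P.J → ℝ) (i : P.I) (j : P.J) : Set (P.J → ℝ) :=
  {x | (i : ℕ) ≤ j ∧ ∀ k : P.J, (i : ℕ) ≤ k → -h i k + x k ≤ -h i j + x j}

/-- For a set `G` of arcs, the intersection of the regions of its arcs, dehomogenized by
`x_{max J̄} = 0`. -/
def cell (P : IJPair) (h : P.I → P.J → ℝ) (G : Set (P.I × P.J)) : Set (P.J → ℝ) :=
  {x | x P.jmax = 0 ∧ ∀ e ∈ G, x ∈ P.region h e.1 e.2}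

/-- The `(I, J̄)`-associahedron: the set of the (nonempty) bounded cells of the polyhedral
decomposition of `{x ∈ ℝ^J̄ : x_{max J̄} = 0}` induced by the tropical hyperplanes `H_i`, `i ∈ I`.
A cell of this decomposition is a nonempty intersection of regions, at least one for each `H_i`. -/
def asso (P : IJPair) (h : P.I → P.J → ℝ) : Set (Set (P.J → ℝ)) :=
  {C | C.Nonempty ∧ Bornology.IsBounded C ∧
    ∃ G : Set (P.I × P.J), (∀ i, ∃ j, (i, j) ∈ G) ∧ C = P.cell h G}

/-- The support of the `(I, J̄)`-associahedron: the union of its cells. -/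
def support (P : IJPair) (h : P.I → P.J → ℝ) : Set (P.J → ℝ) := ⋃₀ P.asso h

end IJPair

end NuAsso

/-!
The regions containing a point `x` give a set of arcs `(i, j̄)`, and the non-crossing condition on
`h` makes any such set non-crossing. From this, the support is described point by point: it
consists of the `x` whose arcs contain `(min I, max J̄)` and cover `J̄`
(`IJPair.mem_support_iff`). In terms of the slacks `y_k = h(min I, k) - h(min I, max J̄) - x_k`
and of `g(i,k) = h(i,k) - h(min I, k)`, this says that `y ≥ 0`, `y_{max J̄} = 0`, and each `j̄`
has an `i ≺ j̄` with `y_j + g(i,j) ≤ y_k + g(i,k)` for all `k̄ ≻ i`.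

*Convexity.* If `j̄₁ ≺ j̄₂` are consecutive and not initial, some point of the support has
`y_{j₂} > 0`, but on scaling it towards `y = 0` it leaves the support, because covering `j̄₂` by
anything but `min I` forces `y_{j₁} - y_{j₂}` to be bounded below by a positive constant
(`IJPair.not_convex_of_hasConsecutiveBars`). Otherwise, each `j̄_s` in `J̄' ∖ {max J̄}` may be
assumed covered by the last `i ≺ j̄_s`, and the support becomes the polytope of the inequalities
`Y_s - Y_t ≤ c(s,t)` for `0 ≤ s < t ≤ d + 1`, where `Y_s = y_{j_s}` and `Y_0 = Y_{d+1} = 0`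
(`IJPair.support_eq_polyhedron`).

*The associahedron.* The array `c` is strictly Monge (`IJPair.barArray_monge`). If `(s,t)` is
matched with the diagonal `(s, t+1)` of a `(d+3)`-gon, the Monge property says that inequalities
of crossing diagonals are never tight together, while a potential built by recursively cutting
intervals (`exists_potential`) makes exactly the inequalities of a given dissection tight. As the
nonempty faces of a polyhedron correspond to the sets of inequalities tight at its points
(`nonempty_faces_orderIso`), this is the face lattice of an associahedron.

*Regularity.* The sum over `i` of the tropical linear forms `max_k (x_k - h(i,k))` is convex, and
its domains of linearity are the cells. When the support is convex, the minimizers on it of this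
sum plus a linear function are a cell, and each cell arises in this way
(`IJPair.minimizers_mem_asso`, `IJPair.exists_minimizers_eq`).
-/

namespace NuAsso

open Filter Topology

/-! ### Polyhedra given by finitely many inequalities -/

section Polyhedra

variable {E ι : Type*} [NormedAddCommGroup E] [NormedSpace ℝ E]

/-- The polyhedron cut out of an affine subspace by the inequalities `a e ≤ 0`. Keeping the
equations in the subspace makes `tight` record the proper inequalities only. -/
def polyhedron (S : AffineSubspace ℝ E) (a : ι → E →ᵃ[ℝ] ℝ) : Set E :=
  {x | x ∈ S ∧ ∀ e, a e x ≤ 0}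

/-- The set of the inequalities `a e ≤ 0` that hold with equality at `x`. -/
def tight (a : ι → E →ᵃ[ℝ] ℝ) (x : E) : Set ι := {e | a e x = 0}

/-- A set-valued function on a nonempty set attains a least value if any two of its values have
a value below their intersection. -/
theorem exists_forall_subset_of_directed {X : Type*} [Finite ι]
    (F : Set X) (hF : F.Nonempty)
    (T : X → Set ι) (h : ∀ x ∈ F, ∀ z ∈ F, ∃ m ∈ F, T m ⊆ T x ∩ T z) :
    ∃ x ∈ F, ∀ z ∈ F, T x ⊆ T z := by
  obtain ⟨x, hx, hmin⟩ : ∃ x ∈ F, ∀ z ∈ F, (T x).ncard ≤ (T z).ncard := by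
    have := WellFounded.has_min (measure fun x => (T x).ncard).wf F hF
    obtain ⟨x, hx, h⟩ := this
    exact ⟨x, hx, fun z hz => not_lt.1 (h z hz)⟩
  refine ⟨x, hx, fun z hz => ?_⟩
  obtain ⟨m, hm, hsub⟩ := h x hx z hz
  have : T m = T x :=
    Set.eq_of_subset_of_ncard_le (hsub.trans Set.inter_subset_left) (hmin m hm) (Set.toFinite _)
  exact this ▸ hsub.trans Set.inter_subset_right

theorem convex_polyhedron (S : AffineSubspace ℝ E) (a : ι → E →ᵃ[ℝ] ℝ) :
    Convex ℝ (polyhedron S a) := by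
  have h : polyhedron S a = (S : Set E) ∩ ⋂ e, a e ⁻¹' Set.Iic 0 := by
    ext x; simp [polyhedron]
  rw [h]
  exact S.convex.inter (convex_iInter fun e => (convex_Iic 0).affine_preimage (a e))

theorem isClosed_polyhedron [FiniteDimensional ℝ E]
    (S : AffineSubspace ℝ E) (a : ι → E →ᵃ[ℝ] ℝ) :
    IsClosed (polyhedron S a) := by
  have h : polyhedron S a = (S : Set E) ∩ ⋂ e, a e ⁻¹' Set.Iic 0 := by
    ext x; simp [polyhedron]
  rw [h]
  exact S.closed_of_finiteDimensional.inter
    (isClosed_iInter fun e => isClosed_Iic.preimage (a e).continuous_of_finiteDimensional)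

/-- If the inequalities tight at `x` are tight at `z`, the segment from `z` to `x` can be
prolonged beyond `x` inside the polyhedron. -/
theorem eventually_lineMap_mem_polyhedron [FiniteDimensional ℝ E] [Finite ι]
    {S : AffineSubspace ℝ E} {a : ι → E →ᵃ[ℝ] ℝ} {x z : E}
    (hx : x ∈ polyhedron S a) (hz : z ∈ S) (h : tight a x ⊆ tight a z) :
    ∀ᶠ t in 𝓝 (0 : ℝ), AffineMap.lineMap x z t ∈ polyhedron S a := by
  have h1 : ∀ e, ∀ᶠ t in 𝓝 (0 : ℝ), a e (AffineMap.lineMap x z t) ≤ 0 := by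
    intro e
    rcases (hx.2 e).eq_or_lt with he | he
    · have hze : a e z = 0 := h he
      refine Eventually.of_forall fun t => ?_
      rw [AffineMap.apply_lineMap, he, hze]
      simp
    · have hc : Continuous fun t : ℝ => a e (AffineMap.lineMap x z t) :=
        (a e).continuous_of_finiteDimensional.comp AffineMap.lineMap_continuous
      have := hc.tendsto 0
      rw [AffineMap.lineMap_apply_zero] at this
      exact (this.eventually (gt_mem_nhds he)).mono fun t ht => le_of_lt ht
  filter_upwards [eventually_all.2 h1] with t ht
  exact ⟨AffineMap.lineMap_mem t hx.1 hz, ht⟩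

theorem exists_lineMap_neg_mem_polyhedron [FiniteDimensional ℝ E] [Finite ι]
    {S : AffineSubspace ℝ E} {a : ι → E →ᵃ[ℝ] ℝ} {x z : E}
    (hx : x ∈ polyhedron S a) (hz : z ∈ S) (h : tight a x ⊆ tight a z) :
    ∃ t : ℝ, 0 < t ∧ AffineMap.lineMap x z (-t) ∈ polyhedron S a := by
  obtain ⟨δ, hδ, hb⟩ := Metric.eventually_nhds_iff.1 (eventually_lineMap_mem_polyhedron hx hz h)
  refine ⟨δ / 2, by positivity, hb ?_⟩
  rw [Real.dist_eq, sub_zero, abs_neg, abs_of_pos (by positivity)]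
  linarith

theorem tight_lineMap_subset {S : AffineSubspace ℝ E} {a : ι → E →ᵃ[ℝ] ℝ} {x z : E}
    (hx : x ∈ polyhedron S a) (hz : z ∈ polyhedron S a) :
    tight a (AffineMap.lineMap x z (1 / 2 : ℝ)) ⊆ tight a x ∩ tight a z := by
  intro e he
  have he' : a e (AffineMap.lineMap x z (1 / 2 : ℝ)) = 0 := he
  rw [AffineMap.apply_lineMap, AffineMap.lineMap_apply_ring'] at he'
  have h1 := hx.2 e
  have h2 := hz.2 e
  exact ⟨show a e x = 0 by linarith, show a e z = 0 by linarith⟩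

/-- A bounded polyhedron is a polytope: it is the convex hull of its extreme points by the
Krein–Milman theorem, and an extreme point is determined by its tight inequalities. -/
theorem isPolytope_polyhedron [FiniteDimensional ℝ E] [Finite ι]
    {S : AffineSubspace ℝ E} {a : ι → E →ᵃ[ℝ] ℝ}
    (hne : (polyhedron S a).Nonempty) (hb : Bornology.IsBounded (polyhedron S a)) :
    IsPolytope (polyhedron S a) := by
  have hcomp : IsCompact (polyhedron S a) :=
    Metric.isCompact_of_isClosed_isBounded (isClosed_polyhedron S a) hb
  have hfin : ((polyhedron S a).extremePoints ℝ).Finite := by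
    refine Set.Finite.of_finite_image (f := tight a) (Set.toFinite _) ?_
    intro x hx z hz hxz
    obtain ⟨t, ht, hw⟩ := exists_lineMap_neg_mem_polyhedron hx.1 hz.1.1 (le_of_eq hxz)
    refine ((mem_extremePoints_iff_left.1 hx).2 z hz.1 _ hw
      ⟨t / (1 + t), 1 / (1 + t), by positivity, by positivity, by field_simp; ring, ?_⟩).symm
    rw [AffineMap.lineMap_apply_module', smul_add, smul_smul, smul_sub]
    have e1 : 1 / (1 + t) * -t = -(t / (1 + t)) := by field_simp
    have e2 : (t / (1 + t)) • x + (1 / (1 + t)) • x = x := by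
      rw [← add_smul, show t / (1 + t) + 1 / (1 + t) = 1 by field_simp; ring, one_smul]
    rw [e1, neg_smul, neg_smul]
    calc _ = (t / (1 + t)) • x + (1 / (1 + t)) • x := by abel
      _ = x := e2
  have hKM := closure_convexHull_extremePoints hcomp (convex_polyhedron S a)
  rw [(hfin.isCompact_convexHull ℝ).isClosed.closure_eq] at hKM
  refine ⟨hfin.toFinset, ?_, by rw [hfin.coe_toFinset, hKM]⟩
  rw [Set.Finite.toFinset_nonempty]
  exact hcomp.extremePoints_nonempty hne

/-- A nonempty exposed face of a polyhedron is cut out by the inequalities tight at one of its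
points, a relatively interior one. -/
theorem exists_eq_of_isExposed [FiniteDimensional ℝ E] [Finite ι]
    {S : AffineSubspace ℝ E} {a : ι → E →ᵃ[ℝ] ℝ} {F : Set E}
    (hF : IsExposed ℝ (polyhedron S a) F) (hne : F.Nonempty) :
    ∃ x ∈ F, F = {z | z ∈ polyhedron S a ∧ tight a x ⊆ tight a z} := by
  obtain ⟨l, hl⟩ := hF hne
  have hsub : F ⊆ polyhedron S a := by rw [hl]; exact fun x hx => hx.1
  have hconv : Convex ℝ F := hF.convex (convex_polyhedron S a)
  obtain ⟨x, hx, hmin⟩ := exists_forall_subset_of_directed F hne (tight a) fun x hx z hz =>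
    ⟨AffineMap.lineMap x z (1 / 2 : ℝ), hconv.lineMap_mem hx hz (by norm_num),
      tight_lineMap_subset (hsub hx) (hsub hz)⟩
  refine ⟨x, hx, Set.Subset.antisymm (fun z hz => ⟨hsub hz, hmin z hz⟩) ?_⟩
  rintro z ⟨hz, hxz⟩
  obtain ⟨t, ht, hw⟩ := exists_lineMap_neg_mem_polyhedron (hsub hx) hz.1 hxz
  rw [hl] at hx ⊢
  refine ⟨hz, fun y hy => (hx.2 y hy).trans ?_⟩
  -- Past `x` in the direction away from `z` the functional `l` cannot increase.
  have h1 := hx.2 _ hw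
  rw [AffineMap.lineMap_apply_module', map_add, map_smul, map_sub, smul_eq_mul] at h1
  nlinarith

/-- The points of a polyhedron at which given inequalities are tight form an exposed face. -/
theorem isExposed_tight [FiniteDimensional ℝ E] [Finite ι]
    (S : AffineSubspace ℝ E) (a : ι → E →ᵃ[ℝ] ℝ) (T : Set ι) :
    IsExposed ℝ (polyhedron S a) {z | z ∈ polyhedron S a ∧ T ⊆ tight a z} := by
  classical
  rintro ⟨z₀, hz₀, hT₀⟩
  have := Fintype.ofFinite ι
  let l : E →ₗ[ℝ] ℝ := ∑ e ∈ T.toFinset, (a e).linear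
  have hl : ∀ y, l y - l z₀ = ∑ e ∈ T.toFinset, a e y := by
    intro y
    rw [← map_sub, LinearMap.sum_apply]
    refine Finset.sum_congr rfl fun e he => ?_
    have h0 : a e z₀ = 0 := hT₀ (Set.mem_toFinset.1 he)
    have := (a e).linearMap_vsub y z₀
    rw [vsub_eq_sub, vsub_eq_sub, h0, sub_zero] at this
    exact this
  have hle : ∀ y ∈ polyhedron S a, l y ≤ l z₀ := fun y hy =>
    sub_nonpos.1 (hl y ▸ Finset.sum_nonpos fun e _ => hy.2 e)
  refine ⟨LinearMap.toContinuousLinearMap l, Set.Subset.antisymm ?_ ?_⟩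
  · rintro z ⟨hz, hT⟩
    refine ⟨hz, fun y hy => ?_⟩
    have : l z - l z₀ = 0 := by
      rw [hl]
      exact Finset.sum_eq_zero fun e he => hT (Set.mem_toFinset.1 he)
    have := hle y hy
    change l y ≤ l z
    linarith
  · rintro z ⟨hz, hmax⟩
    refine ⟨hz, fun e he => ?_⟩
    have h0 : l z - l z₀ = 0 := by
      have h1 : l z₀ ≤ l z := hmax z₀ hz₀
      linarith [hle z hz]
    rw [hl] at h0
    exact (Finset.sum_eq_zero_iff_of_nonpos fun e _ => hz.2 e).1 h0 e (Set.mem_toFinset.2 he)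

/-- If the sets of tight inequalities at points of a polyhedron are exactly the values of an order
embedding `T` of a poset `Δ`, then the nonempty faces of the polyhedron form the poset dual
to `Δ`. -/
theorem nonempty_faces_orderIso [FiniteDimensional ℝ E] [Finite ι]
    {Δ : Type*} [PartialOrder Δ] (S : AffineSubspace ℝ E)
    (a : ι → E →ᵃ[ℝ] ℝ) (T : Δ → Set ι) (hT : ∀ D D', T D ⊆ T D' ↔ D ≤ D')
    (hex : ∀ D, ∃ x ∈ polyhedron S a, tight a x = T D)
    (hall : ∀ x ∈ polyhedron S a, ∃ D, tight a x = T D) :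
    Nonempty ({F : Set E // F.Nonempty ∧ IsExposed ℝ (polyhedron S a) F} ≃o Δᵒᵈ) := by
  let f : Δᵒᵈ → {F : Set E // F.Nonempty ∧ IsExposed ℝ (polyhedron S a) F} := fun D =>
    ⟨{z | z ∈ polyhedron S a ∧ T (OrderDual.ofDual D) ⊆ tight a z}, by
      obtain ⟨x, hx, h⟩ := hex (OrderDual.ofDual D)
      exact ⟨x, hx, h.ge⟩, isExposed_tight S a _⟩
  have hf : ∀ D D', f D ≤ f D' ↔ D ≤ D' := by
    intro D D'
    constructor
    · intro h
      obtain ⟨x, hx, hxD⟩ := hex (OrderDual.ofDual D)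
      have h2 := (h (show x ∈ (f D).1 from ⟨hx, hxD.ge⟩)).2
      rw [hxD, hT] at h2
      exact h2
    · exact fun h z hz => ⟨hz.1, ((hT _ _).2 h).trans hz.2⟩
  have hinj : Function.Injective f := fun D D' h =>
    le_antisymm ((hf _ _).1 h.le) ((hf _ _).1 h.ge)
  have hsurj : Function.Surjective f := by
    rintro ⟨F, hne, hF⟩
    obtain ⟨x, hx, hxF⟩ := exists_eq_of_isExposed hF hne
    obtain ⟨D, hD⟩ := hall x (by rw [hxF] at hx; exact hx.1)
    refine ⟨OrderDual.toDual D, Subtype.ext ?_⟩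
    change {z | z ∈ polyhedron S a ∧ T D ⊆ tight a z} = F
    rw [← hD, hxF]
  exact ⟨OrderIso.symm
    { toEquiv := Equiv.ofBijective f ⟨hinj, hsurj⟩, map_rel_iff' := hf _ _ }⟩

/-- A polyhedron with a point at which no inequality is tight spans its affine subspace. -/
theorem vectorSpan_polyhedron [FiniteDimensional ℝ E] [Finite ι]
    {S : AffineSubspace ℝ E} {a : ι → E →ᵃ[ℝ] ℝ} {x : E}
    (hx : x ∈ polyhedron S a) (h : tight a x = ∅) :
    vectorSpan ℝ (polyhedron S a) = S.direction := by
  apply le_antisymm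
  · rw [AffineSubspace.direction_eq_vectorSpan]
    exact vectorSpan_mono ℝ fun x hx => hx.1
  · intro v hv
    obtain ⟨t, ht, hw⟩ := exists_lineMap_neg_mem_polyhedron hx
      (AffineSubspace.vadd_mem_of_mem_direction hv hx.1) (h ▸ Set.empty_subset _)
    have h1 := vsub_mem_vectorSpan ℝ hw hx
    rw [AffineMap.lineMap_apply_module', vsub_eq_sub, vadd_eq_add, add_sub_cancel_right,
      add_sub_cancel_right, Submodule.smul_mem_iff _ (by linarith : -t ≠ 0).elim] at h1
    exact h1

end Polyhedra

namespace IJPair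

variable {P : IJPair} {h : P.I → P.J → ℝ}

/-! ### Arcs of a point and the support -/

/-- `min I`. -/
def imin (P : IJPair) : P.I := ⟨P.I.min' P.hI, P.I.min'_mem P.hI⟩

theorem le_jmax (j : P.J) : (j : ℕ) ≤ P.jmax := P.J.le_max' j j.2

theorem imin_le (i : P.I) : (P.imin : ℕ) ≤ i := P.I.min'_le i i.2

theorem fst_le_jmax (i : P.I) : (i : ℕ) ≤ P.jmax := (P.I.le_max' i i.2).trans P.max_le

theorem imin_le_snd (j : P.J) : (P.imin : ℕ) ≤ j := P.min_le.trans (P.J.min'_le j j.2)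

/-- The arcs `(i, j̄)` whose region contains `x`. -/
def arcs (h : P.I → P.J → ℝ) (x : P.J → ℝ) : Set (P.I × P.J) := {e | x ∈ P.region h e.1 e.2}

theorem mem_arcs {x : P.J → ℝ} {i : P.I} {j : P.J} :
    (i, j) ∈ arcs h x ↔
      (i : ℕ) ≤ j ∧ ∀ k : P.J, (i : ℕ) ≤ k → -h i k + x k ≤ -h i j + x j := Iff.rfl

theorem mem_cell {x : P.J → ℝ} {G : Set (P.I × P.J)} :
    x ∈ P.cell h G ↔ x P.jmax = 0 ∧ G ⊆ arcs h x := Iff.rfl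

theorem exists_mem_arcs (h : P.I → P.J → ℝ) (x : P.J → ℝ) (i : P.I) :
    ∃ j, (i, j) ∈ arcs h x := by
  obtain ⟨j, hj, hmax⟩ := Finset.exists_max_image
    (Finset.univ.filter fun k : P.J => (i : ℕ) ≤ k) (fun k => -h i k + x k)
    ⟨P.jmax, by simpa using fst_le_jmax i⟩
  exact ⟨j, by simpa using hj, fun k hk => hmax k (by simpa using hk)⟩

/-- The arcs of a point are pairwise non-crossing. -/
theorem not_cross_of_mem_arcs (hh : P.NonCrossing h) {x : P.J → ℝ} {i i' : P.I} {j j' : P.J}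
    (h1 : (i, j) ∈ arcs h x) (h2 : (i', j') ∈ arcs h x) (hi : (i : ℕ) < i') (hij : (i' : ℕ) ≤ j)
    (hj : (j : ℕ) < j') : False := by
  have e1 := h1.2 j' (hi.le.trans (hij.trans hj.le))
  have e2 := h2.2 j hij
  have e3 := hh i i' j j' hi hij hj
  linarith

/-- The points of `{x_{max J̄} = 0}` whose arcs contain `(min I, max J̄)` and cover `J̄`. -/
def IsCovered (h : P.I → P.J → ℝ) (x : P.J → ℝ) : Prop :=
  x P.jmax = 0 ∧ (P.imin, P.jmax) ∈ arcs h x ∧ ∀ j, ∃ i, (i, j) ∈ arcs h x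

theorem IsCovered.mono {x z : P.J → ℝ} (hx : IsCovered h x) (hz : z ∈ P.cell h (arcs h x)) :
    IsCovered h z :=
  ⟨hz.1, hz.2 _ hx.2.1, fun j => (hx.2.2 j).imp fun _ hi => hz.2 _ hi⟩

theorem IsCovered.le_height {x : P.J → ℝ} (hx : IsCovered h x) (k : P.J) :
    x k ≤ h P.imin k - h P.imin P.jmax := by
  have := hx.2.1.2 k (imin_le_snd k)
  rw [hx.1] at this
  linarith

theorem isBounded_isCovered (h : P.I → P.J → ℝ) : Bornology.IsBounded {x | IsCovered h x} := by
  refine (Metric.isBounded_Icc (fun k => -∑ i, |h i k - h i P.jmax|)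
    (fun k => h P.imin k - h P.imin P.jmax)).subset fun x hx => ⟨fun k => ?_, hx.le_height⟩
  obtain ⟨i, hi⟩ := hx.2.2 k
  have h1 := hi.2 P.jmax (fst_le_jmax i)
  rw [hx.1] at h1
  have h2 := Finset.single_le_sum (f := fun i => |h i k - h i P.jmax|)
    (fun i _ => abs_nonneg _) (Finset.mem_univ i)
  have h3 := neg_abs_le (h i k - h i P.jmax)
  change -∑ i, |h i k - h i P.jmax| ≤ x k
  linarith

theorem cell_arcs_mem_asso {x : P.J → ℝ} (hx : IsCovered h x) :
    P.cell h (arcs h x) ∈ P.asso h :=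
  ⟨⟨x, hx.1, fun _ he => he⟩, (isBounded_isCovered h).subset fun _ hz => hx.mono hz, arcs h x,
    exists_mem_arcs h x, rfl⟩

theorem not_isBounded_of_ray {ι : Type*} [Fintype ι] {C : Set (ι → ℝ)} {x v : ι → ℝ} {j : ι}
    (hj : v j ≠ 0) (hC : ∀ t : ℝ, 0 ≤ t → x + t • v ∈ C) : ¬Bornology.IsBounded C := by
  intro hb
  obtain ⟨R, hR⟩ := hb.exists_norm_le
  have hpos : 0 < |v j| := abs_pos.2 hj
  have hR0 : 0 ≤ R := (norm_nonneg _).trans (hR _ (hC 0 le_rfl))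
  have h1 := (norm_le_pi_norm _ j).trans
    (hR _ (hC ((R + |x j| + 1) / |v j|) (by positivity)))
  rw [Pi.add_apply, Pi.smul_apply, smul_eq_mul, Real.norm_eq_abs] at h1
  have h2 := abs_sub_abs_le_abs_sub ((R + |x j| + 1) / |v j| * v j) (-x j)
  rw [abs_mul, abs_div, abs_abs, abs_neg, div_mul_cancel₀ _ hpos.ne',
    abs_of_pos (by positivity : 0 < R + |x j| + 1), sub_neg_eq_add, add_comm (_ * v j)] at h2
  linarith

/-- The support consists of the covered points. If the last arc at `min I` ends at
`j₁ ≺ max J̄`, raising all coordinates up to `j₁` preserves the arcs; if `j` is not covered,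
lowering the coordinate `j` does. -/
theorem mem_support_iff (hh : P.NonCrossing h) {x : P.J → ℝ} :
    x ∈ P.support h ↔ IsCovered h x := by
  constructor
  · rintro ⟨C, ⟨-, hbdd, G, -, rfl⟩, hx⟩
    have hG := (mem_cell.1 hx).2
    have hmax : (P.imin, P.jmax) ∈ arcs h x := by
      obtain ⟨j₁, hj₁, hlast⟩ := Finset.exists_max_image
        (Set.toFinite {j : P.J | (P.imin, j) ∈ arcs h x}).toFinset (fun j => (j : ℕ))
        (by rw [Set.Finite.toFinset_nonempty]; exact exists_mem_arcs h x P.imin)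
      replace hj₁ : (P.imin, j₁) ∈ arcs h x := by simpa using hj₁
      by_contra hcon
      have hlt : (j₁ : ℕ) < P.jmax := by
        refine lt_of_le_of_ne (le_jmax j₁) fun he => hcon ?_
        rwa [← Subtype.ext he]
      refine not_isBounded_of_ray (C := P.cell h G) (x := x)
        (v := fun k : P.J => if (k : ℕ) ≤ j₁ then (1 : ℝ) else 0)
        (j := j₁) (by simp) (fun t ht => ⟨?_, ?_⟩) hbdd
      · simp only [Pi.add_apply, Pi.smul_apply, smul_eq_mul, hx.1, if_neg (not_le.2 hlt)]
        ring
      · rintro ⟨i, k⟩ he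
        have hik := hG he
        refine ⟨hik.1, fun l (hl : (i : ℕ) ≤ l) => ?_⟩
        have h1 := hik.2 l hl
        simp only [Pi.add_apply, Pi.smul_apply, smul_eq_mul]
        dsimp only at h1
        by_cases hk : (k : ℕ) ≤ j₁
        · rw [if_pos hk]
          split_ifs <;> linarith
        · have hi : (j₁ : ℕ) < i := by
            by_contra! hi
            rcases (imin_le i).eq_or_lt with h0 | h0
            · rw [← Subtype.ext h0] at hik
              exact hk (hlast k (by simpa using hik))
            · exact not_cross_of_mem_arcs hh hj₁ hik h0 hi (not_le.1 hk)
          have hl' : ¬(l : ℕ) ≤ j₁ := by omega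
          rw [if_neg hk, if_neg hl']
          linarith
    refine ⟨hx.1, hmax, fun j => ?_⟩
    by_contra! hcon
    have hj : j ≠ P.jmax := fun he => hcon P.imin (he ▸ hmax)
    refine not_isBounded_of_ray (C := P.cell h G) (x := x) (v := Pi.single j (-1)) (j := j)
      (by simp) (fun t ht => ⟨?_, ?_⟩) hbdd
    · simp [hx.1, Pi.single_eq_of_ne hj.symm]
    · rintro ⟨i, k⟩ he
      have hik := hG he
      have hkj : k ≠ j := fun hkj => hcon i (hkj ▸ hik)
      refine ⟨hik.1, fun l hl => ?_⟩
      have h1 := hik.2 l hl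
      by_cases hl' : l = j
      · subst hl'
        simp [Pi.single_eq_of_ne hkj]; linarith
      · simp [Pi.single_eq_of_ne hkj, Pi.single_eq_of_ne hl']; linarith
  · intro hx
    exact ⟨_, cell_arcs_mem_asso hx, hx.1, fun _ he => he⟩

/-! ### The cells as polyhedra -/

/-- The hyperplane `x_{max J̄} = 0`. -/
def hyper (P : IJPair) : AffineSubspace ℝ (P.J → ℝ) :=
  (LinearMap.ker (LinearMap.proj (R := ℝ) (φ := fun _ : P.J => ℝ) P.jmax)).toAffineSubspace

theorem mem_hyper {x : P.J → ℝ} : x ∈ P.hyper ↔ x P.jmax = 0 := by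
  simp [hyper]

/-- The function `x ↦ x_k - h(i,k) - (x_j - h(i,j))`, where `p = ((i, j), k)`. -/
def cellForm (h : P.I → P.J → ℝ) (p : (P.I × P.J) × P.J) : (P.J → ℝ) →ᵃ[ℝ] ℝ :=
  (LinearMap.proj (R := ℝ) (φ := fun _ : P.J => ℝ) p.2
    - LinearMap.proj (R := ℝ) (φ := fun _ : P.J => ℝ) p.1.2).toAffineMap
  - AffineMap.const ℝ _ (h p.1.1 p.2 - h p.1.1 p.1.2)

theorem cellForm_apply (p : (P.I × P.J) × P.J) (x : P.J → ℝ) :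
    cellForm h p x = x p.2 - x p.1.2 - (h p.1.1 p.2 - h p.1.1 p.1.2) := by
  simp [cellForm]

/-- The indices of the inequalities defining the cell of `G`. -/
abbrev CellIndex (G : Set (P.I × P.J)) : Type :=
  {p : (P.I × P.J) × P.J // p.1 ∈ G ∧ (p.1.1 : ℕ) ≤ p.2}

theorem le_of_cell_nonempty {G : Set (P.I × P.J)} (hne : (P.cell h G).Nonempty)
    {e : P.I × P.J} (he : e ∈ G) : (e.1 : ℕ) ≤ e.2 :=
  (hne.some_mem.2 e he).1

theorem cell_eq_polyhedron {G : Set (P.I × P.J)} (hne : (P.cell h G).Nonempty) :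
    P.cell h G = polyhedron P.hyper fun p : CellIndex G => cellForm h p.1 := by
  ext x
  constructor
  · rintro ⟨h0, hx⟩
    refine ⟨mem_hyper.2 h0, fun p => ?_⟩
    have := (hx _ p.2.1).2 p.1.2 p.2.2
    rw [cellForm_apply]
    linarith
  · rintro ⟨h0, hx⟩
    refine ⟨mem_hyper.1 h0, fun e he => ⟨le_of_cell_nonempty hne he, fun k hk => ?_⟩⟩
    have := hx ⟨(e, k), he, hk⟩
    rw [cellForm_apply] at this
    dsimp only at this
    linarith

/-- Imposing equality in some of the inequalities of a cell enlarges its set of arcs. -/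
theorem tight_cell_eq {G : Set (P.I × P.J)} (hne : (P.cell h G).Nonempty)
    (T : Set (CellIndex G)) :
    {z | z ∈ P.cell h G ∧ T ⊆ tight (fun p : CellIndex G => cellForm h p.1) z} =
      P.cell h (G ∪ {e | ∃ p ∈ T, e = (p.1.1.1, p.1.2)}) := by
  ext z
  constructor
  · rintro ⟨hz, hT⟩
    refine ⟨hz.1, ?_⟩
    rintro e (he | ⟨p, hp, rfl⟩)
    · exact hz.2 e he
    · have h1 := hz.2 _ p.2.1
      have h2 : cellForm h p.1 z = 0 := hT hp
      rw [cellForm_apply] at h2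
      refine ⟨p.2.2, fun k hk => ?_⟩
      have := h1.2 k hk
      dsimp only
      linarith
  · intro hz
    have hz' : z ∈ P.cell h G := ⟨hz.1, fun e he => hz.2 e (Or.inl he)⟩
    refine ⟨hz', fun p hp => ?_⟩
    have h1 := (hz.2 (p.1.1.1, p.1.2) (Or.inr ⟨p, hp, rfl⟩)).2 p.1.1.2
      (le_of_cell_nonempty hne p.2.1)
    have h2 := (hz'.2 _ p.2.1).2 p.1.2 p.2.2
    change cellForm h p.1 z = 0
    rw [cellForm_apply]
    dsimp only at h1 h2
    linarith

theorem convex_cell (h : P.I → P.J → ℝ) (G : Set (P.I × P.J)) : Convex ℝ (P.cell h G) := by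
  rcases (P.cell h G).eq_empty_or_nonempty with h0 | h0
  · rw [h0]; exact convex_empty
  · rw [cell_eq_polyhedron h0]
    exact convex_polyhedron _ _

theorem finite_asso (h : P.I → P.J → ℝ) : (P.asso h).Finite :=
  (Set.finite_range (P.cell h)).subset fun _ ⟨_, _, G, _, hG⟩ => ⟨G, hG.symm⟩

theorem isPolytope_of_mem_asso {C : Set (P.J → ℝ)} (hC : C ∈ P.asso h) : IsPolytope C := by
  obtain ⟨hne, hb, G, -, rfl⟩ := hC
  have e := cell_eq_polyhedron hne
  rw [e] at hb hne ⊢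
  exact isPolytope_polyhedron hne hb

theorem isExposed_cell_inter {G G' : Set (P.I × P.J)} (hG : ∀ i, ∃ j, (i, j) ∈ G)
    (hne : (P.cell h G ∩ P.cell h G').Nonempty) :
    IsExposed ℝ (P.cell h G) (P.cell h G ∩ P.cell h G') := by
  have hneG := hne.mono Set.inter_subset_left
  have hneG' := hne.mono Set.inter_subset_right
  let T : Set (CellIndex G) := {p | (p.1.1.1, p.1.2) ∈ G'}
  have h1 : P.cell h G ∩ P.cell h G' =
      {z | z ∈ P.cell h G ∧ T ⊆ tight (fun p : CellIndex G => cellForm h p.1) z} := by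
    rw [tight_cell_eq hneG]
    ext z
    constructor
    · rintro ⟨hz, hz'⟩
      refine ⟨hz.1, ?_⟩
      rintro e (he | ⟨p, hp, rfl⟩)
      exacts [hz.2 e he, hz'.2 _ hp]
    · intro hz
      refine ⟨⟨hz.1, fun e he => hz.2 e (Or.inl he)⟩, hz.1, fun e he => hz.2 e (Or.inr ?_)⟩
      obtain ⟨j, hj⟩ := hG e.1
      exact ⟨⟨((e.1, j), e.2), hj, le_of_cell_nonempty hneG' he⟩, he, rfl⟩
  rw [h1, cell_eq_polyhedron hneG]
  exact isExposed_tight _ _ _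

/-- The bounded cells form a polyhedral subdivision of the support, convex or not. -/
theorem isPolyhedralSubdivision_asso (h : P.I → P.J → ℝ) :
    IsPolyhedralSubdivision (P.asso h) (P.support h) := by
  refine ⟨finite_asso h, fun C hC => isPolytope_of_mem_asso hC, ?_, ?_, rfl⟩
  · rintro C ⟨hne, hb, G, hG, rfl⟩ F hFne hF
    have hsub : F ⊆ P.cell h G := hF.subset
    have hF' := hF
    rw [cell_eq_polyhedron hne] at hF'
    obtain ⟨x, -, hx⟩ := exists_eq_of_isExposed hF' hFne
    rw [← cell_eq_polyhedron hne, tight_cell_eq hne] at hx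
    exact ⟨hFne, hb.subset hsub, _, fun i => (hG i).imp fun j hj => Or.inl hj, hx⟩
  · rintro C ⟨-, -, G, hG, rfl⟩ D ⟨-, -, G', hG', rfl⟩ hne
    refine ⟨isExposed_cell_inter hG hne, ?_⟩
    rw [Set.inter_comm] at hne ⊢
    exact isExposed_cell_inter hG' hne

/-! ### Regularity of the subdivision -/

theorem nonempty_bars (i : P.I) :
    (Finset.univ.filter fun k : P.J => (i : ℕ) ≤ k).Nonempty :=
  ⟨P.jmax, by simpa using fst_le_jmax i⟩

/-- The tropical linear form `max_k (x_k - h(i,k))` defining `H_i`. -/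
noncomputable def tropForm (h : P.I → P.J → ℝ) (i : P.I) (x : P.J → ℝ) : ℝ :=
  (Finset.univ.filter fun k : P.J => (i : ℕ) ≤ k).sup' (nonempty_bars i) fun k => x k - h i k

theorem le_tropForm {i : P.I} {k : P.J} (hk : (i : ℕ) ≤ k) (x : P.J → ℝ) :
    x k - h i k ≤ tropForm h i x :=
  Finset.le_sup' (fun k => x k - h i k) (by simpa using hk)

theorem mem_arcs_iff_tropForm {x : P.J → ℝ} {i : P.I} {j : P.J} :
    (i, j) ∈ arcs h x ↔ (i : ℕ) ≤ j ∧ tropForm h i x = x j - h i j := by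
  rw [mem_arcs]
  refine and_congr_right fun hij => ⟨fun hx => le_antisymm ?_ (le_tropForm hij x), ?_⟩
  · refine Finset.sup'_le _ _ fun k hk => ?_
    have := hx k (by simpa using hk)
    linarith
  · intro he k hk
    have := le_tropForm (h := h) hk x
    linarith

theorem tropForm_midpoint_le (i : P.I) (x z : P.J → ℝ) :
    tropForm h i (AffineMap.lineMap x z (1 / 2 : ℝ)) ≤ (tropForm h i x + tropForm h i z) / 2 := by
  refine Finset.sup'_le _ _ fun k hk => ?_
  have hk' : (i : ℕ) ≤ k := by simpa using hk
  have h1 := le_tropForm (h := h) hk' x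
  have h2 := le_tropForm (h := h) hk' z
  rw [AffineMap.lineMap_apply_module']
  simp only [Pi.add_apply, Pi.smul_apply, Pi.sub_apply, smul_eq_mul]
  linarith

/-- If a tropical linear form is affine between two points, then the arcs at `i` of their midpoint
are arcs of both. -/
theorem mem_arcs_of_midpoint {x z : P.J → ℝ} {i : P.I} {j : P.J}
    (hm : (i, j) ∈ arcs h (AffineMap.lineMap x z (1 / 2 : ℝ)))
    (he : (tropForm h i x + tropForm h i z) / 2 ≤
      tropForm h i (AffineMap.lineMap x z (1 / 2 : ℝ))) :
    (i, j) ∈ arcs h x ∧ (i, j) ∈ arcs h z := by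
  obtain ⟨hij, hm⟩ := mem_arcs_iff_tropForm.1 hm
  rw [hm, AffineMap.lineMap_apply_module'] at he
  simp only [Pi.add_apply, Pi.smul_apply, Pi.sub_apply, smul_eq_mul] at he
  have h1 := le_tropForm (h := h) hij x
  have h2 := le_tropForm (h := h) hij z
  exact ⟨mem_arcs_iff_tropForm.2 ⟨hij, by linarith⟩, mem_arcs_iff_tropForm.2 ⟨hij, by linarith⟩⟩

/-- The sum of the tropical linear forms: its domains of linearity are the cells, so it serves as
the height function of the regular subdivision. -/
noncomputable def tropSum (h : P.I → P.J → ℝ) (x : P.J → ℝ) : ℝ := ∑ i, tropForm h i x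

theorem tropSum_midpoint_le (x z : P.J → ℝ) :
    tropSum h (AffineMap.lineMap x z (1 / 2 : ℝ)) ≤ (tropSum h x + tropSum h z) / 2 := by
  rw [tropSum, tropSum, tropSum, ← Finset.sum_add_distrib, Finset.sum_div]
  exact Finset.sum_le_sum fun i _ => tropForm_midpoint_le i x z

theorem arcs_midpoint_subset {x z : P.J → ℝ}
    (he : (tropSum h x + tropSum h z) / 2 ≤ tropSum h (AffineMap.lineMap x z (1 / 2 : ℝ))) :
    arcs h (AffineMap.lineMap x z (1 / 2 : ℝ)) ⊆ arcs h x ∩ arcs h z := by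
  rintro ⟨i, j⟩ hm
  refine mem_arcs_of_midpoint hm ?_
  rw [tropSum, tropSum, tropSum, ← Finset.sum_add_distrib, Finset.sum_div] at he
  have heq := le_antisymm he (Finset.sum_le_sum fun i _ => tropForm_midpoint_le i x z)
  exact ((Finset.sum_eq_sum_iff_of_le fun i _ => tropForm_midpoint_le i x z).1 heq.symm i
    (Finset.mem_univ i)).ge

/-- On a cell the sum of the tropical linear forms agrees with an affine function. -/
theorem exists_affine_tropSum {G : Set (P.I × P.J)} (hG : ∀ i, ∃ j, (i, j) ∈ G) :
    ∃ ℓ : (P.J → ℝ) →ᵃ[ℝ] ℝ, ∀ x ∈ P.cell h G, tropSum h x = ℓ x := by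
  choose j hj using hG
  refine ⟨(∑ i, LinearMap.proj (R := ℝ) (φ := fun _ : P.J => ℝ) (j i)).toAffineMap
    - AffineMap.const ℝ _ (∑ i, h i (j i)), fun x hx => ?_⟩
  rw [tropSum]
  simp only [AffineMap.coe_sub, Pi.sub_apply, LinearMap.coe_toAffineMap, LinearMap.sum_apply,
    LinearMap.proj_apply, AffineMap.const_apply]
  rw [← Finset.sum_sub_distrib]
  exact Finset.sum_congr rfl fun i _ => (mem_arcs_iff_tropForm.1 (hx.2 _ (hj i))).2

theorem cell_subset_support {C : Set (P.J → ℝ)} (hC : C ∈ P.asso h) : C ⊆ P.support h :=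
  Set.subset_sUnion_of_mem hC

/-- The segment from `z` to `x` in the cell of `x` can be prolonged beyond `x` in this cell. -/
theorem exists_lineMap_neg_mem_cell {x z : P.J → ℝ} (hx : x P.jmax = 0)
    (hz : z ∈ P.cell h (arcs h x)) :
    ∃ t : ℝ, 0 < t ∧ AffineMap.lineMap x z (-t) ∈ P.cell h (arcs h x) := by
  have hxc : x ∈ P.cell h (arcs h x) := ⟨hx, fun _ he => he⟩
  have hne : (P.cell h (arcs h x)).Nonempty := ⟨z, hz⟩
  have e := cell_eq_polyhedron hne
  rw [e]
  refine exists_lineMap_neg_mem_polyhedron (e ▸ hxc) (mem_hyper.2 hz.1) fun p hp => ?_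
  -- An inequality tight at `x` amounts to a further arc of `x`, hence of `z`.
  have hT := tight_cell_eq (h := h) hne {p}
  have h1 : x ∈ {z | z ∈ P.cell h (arcs h x) ∧
      {p} ⊆ tight (fun p : CellIndex (arcs h x) => cellForm h p.1) z} :=
    ⟨hxc, by simpa using hp⟩
  rw [hT] at h1
  have h2 : z ∈ {z | z ∈ P.cell h (arcs h x) ∧
      {p} ⊆ tight (fun p : CellIndex (arcs h x) => cellForm h p.1) z} := by
    rw [hT]
    exact ⟨hz.1, fun e he => hz.2 e (h1.2 e he)⟩
  exact h2.2 rfl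

/-- The points of the support at which `a + tropSum h` is minimal. -/
def minimizers (h : P.I → P.J → ℝ) (a : (P.J → ℝ) →ₗ[ℝ] ℝ) : Set (P.J → ℝ) :=
  {x | x ∈ P.support h ∧ ∀ z ∈ P.support h, a x + tropSum h x ≤ a z + tropSum h z}

/-- If the support is convex, the minimizers of `a + tropSum h` form a cell. -/
theorem minimizers_mem_asso (hh : P.NonCrossing h) (hconv : Convex ℝ (P.support h))
    {a : (P.J → ℝ) →ₗ[ℝ] ℝ} (hne : (minimizers h a).Nonempty) : minimizers h a ∈ P.asso h := by
  obtain ⟨x, hx, hmin⟩ := exists_forall_subset_of_directed (minimizers h a) hne (arcs h) (by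
    intro x hx z hz
    have hm : AffineMap.lineMap x z (1 / 2 : ℝ) ∈ P.support h :=
      hconv.lineMap_mem hx.1 hz.1 (by norm_num)
    have ha : a (AffineMap.lineMap x z (1 / 2 : ℝ)) = (a x + a z) / 2 := by
      rw [AffineMap.lineMap_apply_module', map_add, map_smul, map_sub, smul_eq_mul]; ring
    have h1 := hx.2 _ hm
    have h2 := hz.2 _ hm
    have h3 := tropSum_midpoint_le (h := h) x z
    refine ⟨_, ⟨hm, fun w hw => ?_⟩, arcs_midpoint_subset ?_⟩
    · have h4 := hx.2 w hw
      have h5 := hz.2 w hw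
      linarith
    · linarith)
  have hcov := (mem_support_iff hh).1 hx.1
  have hC := cell_arcs_mem_asso hcov
  have heq : minimizers h a = P.cell h (arcs h x) := by
    refine Set.Subset.antisymm
      (fun z hz => ⟨((mem_support_iff hh).1 hz.1).1, hmin z hz⟩) fun z hz => ?_
    refine ⟨cell_subset_support hC hz, fun y hy => (le_trans ?_ (hx.2 y hy))⟩
    obtain ⟨t, ht, hw⟩ := exists_lineMap_neg_mem_cell hcov.1 hz
    obtain ⟨ℓ, hℓ⟩ := exists_affine_tropSum (h := h) (exists_mem_arcs h x)
    have h1 := hx.2 _ (cell_subset_support hC hw)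
    rw [hℓ _ hw, hℓ x ⟨hcov.1, fun _ he => he⟩, AffineMap.apply_lineMap,
      AffineMap.lineMap_apply_module', AffineMap.lineMap_apply_ring', map_add, map_smul, map_sub,
      smul_eq_mul] at h1
    rw [hℓ z hz, hℓ x ⟨hcov.1, fun _ he => he⟩]
    nlinarith
  rw [heq]
  exact hC

/-- Every cell is a set of minimizers: for the cell of `G`, subtract from each tropical linear
form the average of its terms over the arcs of `G`. -/
theorem exists_minimizers_eq (hh : P.NonCrossing h) {C : Set (P.J → ℝ)} (hC : C ∈ P.asso h) :
    ∃ a : (P.J → ℝ) →ₗ[ℝ] ℝ, minimizers h a = C := by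
  classical
  have hsub := cell_subset_support hC
  obtain ⟨hne, -, G, hG, rfl⟩ := hC
  let n : P.I → ℝ := fun i => ((Finset.univ.filter fun j => (i, j) ∈ G).card : ℝ)
  have hn : ∀ i, 0 < n i := fun i => by
    obtain ⟨j, hj⟩ := hG i
    exact Nat.cast_pos.2 (Finset.card_pos.2 ⟨j, by simpa using hj⟩)
  let a : (P.J → ℝ) →ₗ[ℝ] ℝ := -∑ i, (n i)⁻¹ • ∑ j ∈ Finset.univ.filter fun j => (i, j) ∈ G,
    LinearMap.proj (R := ℝ) (φ := fun _ : P.J => ℝ) j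
  let c : ℝ := ∑ i, (n i)⁻¹ * ∑ j ∈ Finset.univ.filter fun j => (i, j) ∈ G, h i j
  have key : ∀ x, a x + tropSum h x + c = ∑ i, (n i)⁻¹ *
      ∑ j ∈ Finset.univ.filter fun j => (i, j) ∈ G, (tropForm h i x - (x j - h i j)) := by
    intro x
    simp only [a, c, tropSum, LinearMap.neg_apply, LinearMap.sum_apply, LinearMap.smul_apply,
      LinearMap.proj_apply, smul_eq_mul]
    rw [← Finset.sum_neg_distrib, ← Finset.sum_add_distrib, ← Finset.sum_add_distrib]
    refine Finset.sum_congr rfl fun i _ => ?_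
    rw [Finset.sum_sub_distrib, Finset.sum_sub_distrib, Finset.sum_const, nsmul_eq_mul]
    have : (n i)⁻¹ * (n i * tropForm h i x) = tropForm h i x := by
      rw [← mul_assoc, inv_mul_cancel₀ (hn i).ne', one_mul]
    change _ = (n i)⁻¹ * (n i * tropForm h i x - _)
    rw [mul_sub, this]
    ring
  have hterm : ∀ x i, ∀ j ∈ Finset.univ.filter (fun j => (i, j) ∈ G),
      0 ≤ tropForm h i x - (x j - h i j) := fun x i j hj =>
    sub_nonneg.2 (le_tropForm (le_of_cell_nonempty hne (by simpa using hj)) x)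
  have hterm' : ∀ x i, 0 ≤ (n i)⁻¹ *
      ∑ j ∈ Finset.univ.filter fun j => (i, j) ∈ G, (tropForm h i x - (x j - h i j)) :=
    fun x i => mul_nonneg (inv_nonneg.2 (hn i).le) (Finset.sum_nonneg (hterm x i))
  have hnonneg : ∀ x, 0 ≤ a x + tropSum h x + c := fun x => by
    rw [key]; exact Finset.sum_nonneg fun i _ => hterm' x i
  have hzero : ∀ x, x P.jmax = 0 → (a x + tropSum h x + c = 0 ↔ x ∈ P.cell h G) := by
    intro x hx
    rw [key, Finset.sum_eq_zero_iff_of_nonneg fun i _ => hterm' x i]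
    constructor
    · intro h0
      refine ⟨hx, fun e he => mem_arcs_iff_tropForm.2 ⟨le_of_cell_nonempty hne he, ?_⟩⟩
      have h1 := (mul_eq_zero.1 (h0 e.1 (Finset.mem_univ _))).resolve_left
        (inv_ne_zero (hn e.1).ne')
      have h2 := (Finset.sum_eq_zero_iff_of_nonneg (hterm x e.1)).1 h1 e.2 (by simpa using he)
      linarith
    · intro hxG i _
      rw [Finset.sum_eq_zero, mul_zero]
      intro j hj
      rw [(mem_arcs_iff_tropForm.1 (hxG.2 (i, j) (by simpa using hj))).2, sub_self]
  refine ⟨a, Set.Subset.antisymm ?_ ?_⟩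
  · rintro x ⟨hx, hmin⟩
    obtain ⟨x₀, hx₀⟩ := hne
    rw [← hzero x ((mem_support_iff hh).1 hx).1]
    have h1 := (hzero x₀ hx₀.1).2 hx₀
    have h2 := hmin x₀ (hsub hx₀)
    linarith [hnonneg x]
  · intro x hx
    refine ⟨hsub hx, fun z _ => ?_⟩
    have h1 := (hzero x hx.1).2 hx
    linarith [hnonneg z]

theorem isRegularSubdivision_asso (hh : P.NonCrossing h) (hconv : Convex ℝ (P.support h))
    (hne : (P.support h).Nonempty) : IsRegularSubdivision (P.asso h) (P.support h) := by
  classical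
  refine ⟨isPolyhedralSubdivision_asso h, ?_⟩
  choose! s hs using fun C (hC : C ∈ P.asso h) => isPolytope_of_mem_asso hC
  let A : Finset (P.J → ℝ) := (finite_asso h).toFinset.biUnion s
  have hsA : ∀ C ∈ P.asso h, s C ⊆ A := fun C hC =>
    Finset.subset_biUnion_of_mem s ((finite_asso h).mem_toFinset.2 hC)
  have hsC : ∀ C ∈ P.asso h, ∀ v ∈ s C, v ∈ C := fun C hC v hv => by
    rw [(hs C hC).2]; exact subset_convexHull ℝ _ hv
  have hAP : ∀ v ∈ A, v ∈ P.support h := by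
    intro v hv
    obtain ⟨C, hC, hvC⟩ := Finset.mem_biUnion.1 hv
    rw [Set.Finite.mem_toFinset] at hC
    exact cell_subset_support hC (hsC C hC v hvC)
  have hAne : A.Nonempty := by
    obtain ⟨x, C, hC, -⟩ := hne
    exact (hs C hC).1.mono (hsA C hC)
  have hlow : ∀ (a : (P.J → ℝ) →ₗ[ℝ] ℝ), ∀ x ∈ P.support h, ∃ v ∈ A,
      a v + tropSum h v ≤ a x + tropSum h x := by
    rintro a x ⟨C, hC, hx⟩
    obtain ⟨-, -, G, hG, hCG⟩ := id hC
    obtain ⟨ℓ, hℓ⟩ := exists_affine_tropSum (h := h) hG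
    rw [← hCG] at hℓ
    have hx' := hx
    rw [(hs C hC).2] at hx'
    have hcc : ConcaveOn ℝ (convexHull ℝ (s C : Set (P.J → ℝ))) (a.toAffineMap + ℓ) :=
      (concaveOn_id convex_univ).comp_affineMap (a.toAffineMap + ℓ) |>.subset
        (Set.subset_univ _) (convex_convexHull ℝ _)
    obtain ⟨v, hv, hle⟩ := hcc.exists_le_of_mem_convexHull (subset_convexHull ℝ _) hx'
    refine ⟨v, hsA C hC hv, ?_⟩
    rw [hℓ v (hsC C hC v hv), hℓ x hx]
    exact hle
  have hface : ∀ a : (P.J → ℝ) →ₗ[ℝ] ℝ, minimizers h a ∈ P.asso h ∧ minimizers h a =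
      convexHull ℝ {v | v ∈ A ∧ ∀ u ∈ A, a v + tropSum h v ≤ a u + tropSum h u} := by
    intro a
    have hset : {v | v ∈ A ∧ ∀ u ∈ A, a v + tropSum h v ≤ a u + tropSum h u} =
        {v | v ∈ A ∧ v ∈ minimizers h a} := by
      ext v
      refine and_congr_right fun hv => ⟨fun hu => ⟨hAP v hv, fun z hz => ?_⟩,
        fun hm u hu => hm.2 u (hAP u hu)⟩
      obtain ⟨u, huA, hle⟩ := hlow a z hz
      exact (hu u huA).trans hle
    have hmem : minimizers h a ∈ P.asso h := by
      apply minimizers_mem_asso hh hconv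
      obtain ⟨v, hv, hmin⟩ := A.exists_min_image (fun v => a v + tropSum h v) hAne
      have : v ∈ {v | v ∈ A ∧ ∀ u ∈ A, a v + tropSum h v ≤ a u + tropSum h u} := ⟨hv, hmin⟩
      rw [hset] at this
      exact ⟨v, this.2⟩
    refine ⟨hmem, ?_⟩
    rw [hset]
    apply Set.Subset.antisymm
    · nth_rewrite 1 [(hs _ hmem).2]
      exact convexHull_mono fun v hv => ⟨hsA _ hmem hv, hsC _ hmem v hv⟩
    · refine convexHull_min (fun v hv => hv.2) ?_
      obtain ⟨-, -, G, -, hG⟩ := hmem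
      rw [hG]
      exact convex_cell h G
  refine ⟨A, tropSum h, hAne, Set.Subset.antisymm (convexHull_min hAP hconv) ?_, ?_⟩
  · rintro x ⟨C, hC, hx⟩
    rw [(hs C hC).2] at hx
    exact convexHull_mono (hsA C hC) hx
  · ext C
    constructor
    · intro hC
      obtain ⟨a, rfl⟩ := exists_minimizers_eq hh hC
      exact ⟨a, (hface a).2⟩
    · rintro ⟨a, rfl⟩
      rw [← (hface a).2]
      exact (hface a).1

/-! ### Consecutive bars obstruct convexity -/

theorem plain_mem_nodes {A B : Finset ℕ} {i : ℕ} : plain i ∈ nodes A B ↔ i ∈ A := by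
  simp [nodes, plain, bar]

theorem bar_mem_nodes {A B : Finset ℕ} {j : ℕ} : bar j ∈ nodes A B ↔ j ∈ B := by
  simp [nodes, plain, bar]

theorem plain_lt_plain {i j : ℕ} : plain i < plain j ↔ i < j := by
  simp [plain, Prod.Lex.toLex_lt_toLex]

theorem bar_lt_bar {i j : ℕ} : bar i < bar j ↔ i < j := by
  simp [bar, Prod.Lex.toLex_lt_toLex]

theorem mem_nodes {A B : Finset ℕ} {v : Node} :
    v ∈ nodes A B ↔ (∃ i ∈ A, v = plain i) ∨ ∃ j ∈ B, v = bar j := by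
  simp [nodes, eq_comm]

theorem mem_innerJ {j : ℕ} :
    j ∈ P.innerJ ↔ j ≠ P.jmax ∧ j ∈ P.J ∧ ∃ i : P.I, (P.imin : ℕ) < i ∧ (i : ℕ) ≤ j := by
  rw [innerJ, Finset.mem_erase, J', Finset.mem_filter]
  refine and_congr_right fun _ => and_congr_right fun _ => ⟨?_, ?_⟩
  · rintro ⟨i₁, h₁, i₂, h₂, hlt, hle⟩
    exact ⟨⟨i₂, h₂⟩, (imin_le ⟨i₁, h₁⟩).trans_lt hlt, hle⟩
  · rintro ⟨i, hi, hle⟩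
    exact ⟨P.imin, P.imin.2, i, i.2, hi, hle⟩

theorem hasConsecutiveBars_iff : P.HasConsecutiveBars ↔
    ∃ j₁ ∈ P.innerJ, ∃ j₂ ∈ P.innerJ, j₁ < j₂ ∧ ∀ i ∈ P.I, j₁ < i → ¬i ≤ j₂ := by
  constructor
  · rintro ⟨j₁, j₂, h₁, h₂, hlt, hno⟩
    refine ⟨j₁, bar_mem_nodes.1 h₁, j₂, bar_mem_nodes.1 h₂, bar_lt_bar.1 hlt, ?_⟩
    intro i hi h₃ h₄
    exact hno _ (plain_mem_nodes.2 hi) ⟨(bar_lt_plain _ _).2 h₃, (plain_lt_bar _ _).2 h₄⟩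
  · rintro ⟨j₁, h₁, j₂, h₂, hlt, hno⟩
    -- Replace `j₂` by the successor of `j₁`.
    obtain ⟨j₃, h₃, hmin⟩ := Finset.exists_min_image (P.innerJ.filter (j₁ < ·)) id
      ⟨j₂, by simp [h₂, hlt]⟩
    rw [Finset.mem_filter] at h₃
    refine ⟨j₁, j₃, bar_mem_nodes.2 h₁, bar_mem_nodes.2 h₃.1, bar_lt_bar.2 h₃.2, ?_⟩
    rintro v hv ⟨hv₁, hv₂⟩
    rcases mem_nodes.1 hv with ⟨i, hi, rfl⟩ | ⟨j, hj, rfl⟩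
    · have h₄ : j₃ ≤ j₂ := hmin j₂ (by simp [h₂, hlt])
      exact hno i hi ((bar_lt_plain _ _).1 hv₁) (((plain_lt_bar _ _).1 hv₂).trans h₄)
    · have h₄ : j₃ ≤ j := hmin j (by simp [hj, bar_lt_bar.1 hv₁])
      exact absurd (bar_lt_bar.1 hv₂) (not_lt.2 h₄)

theorem NonCrossing.le (hh : P.NonCrossing h) {i i' : P.I} {j j' : P.J} (h1 : (i : ℕ) ≤ i')
    (h2 : (i' : ℕ) ≤ j) (h3 : (j : ℕ) ≤ j') : h i j' + h i' j ≤ h i j + h i' j' := by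
  rcases h1.eq_or_lt with h1 | h1
  · rw [Subtype.ext h1]; linarith
  rcases h3.eq_or_lt with h3 | h3
  · rw [Subtype.ext h3]
  exact (hh i i' j j' h1 h2 h3).le

/-- A point of the support at which `i₀` covers all `j̄ ≻ i₀` while `min I` covers the others. -/
def supportPoint (h : P.I → P.J → ℝ) (i₀ : P.I) : P.J → ℝ := fun k =>
  if (i₀ : ℕ) ≤ k then h i₀ k - h i₀ P.jmax else h P.imin k - h P.imin P.jmax

theorem supportPoint_mem (hh : P.NonCrossing h) (i₀ : P.I) :
    supportPoint h i₀ ∈ P.support h := by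
  have hle : ∀ k, supportPoint h i₀ k ≤ h P.imin k - h P.imin P.jmax := by
    intro k
    unfold supportPoint
    split_ifs with hk
    · linarith [hh.le (imin_le i₀) hk (le_jmax k)]
    · exact le_rfl
  have h0 : supportPoint h i₀ P.jmax = 0 := by simp [supportPoint]
  refine (mem_support_iff hh).2 ⟨h0, ⟨imin_le_snd _, fun k _ => ?_⟩, fun j => ?_⟩
  · rw [h0]; linarith [hle k]
  · by_cases hj : (i₀ : ℕ) ≤ j
    · refine ⟨i₀, hj, fun k (hk : (i₀ : ℕ) ≤ k) => ?_⟩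
      simp only [supportPoint, if_pos hk, if_pos hj]
      linarith
    · refine ⟨P.imin, imin_le_snd _, fun k _ => ?_⟩
      have := hle k
      simp only [supportPoint, if_neg hj] at this ⊢
      linarith

theorem support_nonempty (hh : P.NonCrossing h) : (P.support h).Nonempty :=
  ⟨_, supportPoint_mem hh P.imin⟩

/-- Near the point at which `min I` covers everything, in a direction in which `j̄₂` is no longer
covered by `min I`, no other `i` can cover `j̄₂` unless `i` lies between `j̄₁` and `j̄₂`. -/
theorem not_convex_of_hasConsecutiveBars (hh : P.NonCrossing h) (hc : P.HasConsecutiveBars) :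
    ¬Convex ℝ (P.support h) := by
  intro hconv
  obtain ⟨n₁, hn₁, n₂, hn₂, hlt, hno⟩ := hasConsecutiveBars_iff.1 hc
  obtain ⟨-, hJ₁, i₀, hi₀, hi₀'⟩ := mem_innerJ.1 hn₁
  obtain ⟨hne, hJ₂, -⟩ := mem_innerJ.1 hn₂
  obtain ⟨j₁, rfl⟩ : ∃ j : P.J, (j : ℕ) = n₁ := ⟨⟨n₁, hJ₁⟩, rfl⟩
  obtain ⟨j₂, rfl⟩ : ∃ j : P.J, (j : ℕ) = n₂ := ⟨⟨n₂, hJ₂⟩, rfl⟩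
  let m : ℝ → P.J → ℝ := AffineMap.lineMap (supportPoint h P.imin) (supportPoint h i₀)
  have hm : ∀ t k, m t k = supportPoint h P.imin k +
      t * (supportPoint h i₀ k - supportPoint h P.imin k) := by
    intro t k
    simp only [m, AffineMap.lineMap_apply_module', Pi.add_apply, Pi.smul_apply, Pi.sub_apply,
      smul_eq_mul]
    ring
  have hev : ∀ᶠ t in 𝓝[>] (0 : ℝ), ∀ i : P.I, (P.imin : ℕ) < i → (i : ℕ) ≤ j₁ →
      h i j₁ - h i j₂ < m t j₁ - m t j₂ := by
    refine eventually_all.2 fun i => ?_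
    by_cases hi : (P.imin : ℕ) < i ∧ (i : ℕ) ≤ j₁
    · have h1 := hh P.imin i j₁ j₂ hi.1 hi.2 hlt
      have hcont : Continuous fun t => m t j₁ - m t j₂ := by
        simp only [hm]; fun_prop
      have h2 : h i j₁ - h i j₂ < m 0 j₁ - m 0 j₂ := by
        simp only [hm, supportPoint, if_pos (imin_le_snd j₁), if_pos (imin_le_snd j₂)]
        linarith
      have h3 := (hcont.tendsto 0).eventually (lt_mem_nhds h2)
      exact (h3.filter_mono nhdsWithin_le_nhds).mono fun t ht _ _ => ht
    · exact Eventually.of_forall fun t h1 h2 => absurd ⟨h1, h2⟩ hi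
  obtain ⟨t, ht, ht0, ht1⟩ := (hev.and (Ioo_mem_nhdsGT (zero_lt_one' ℝ))).exists
  have hmem : m t ∈ P.support h := hconv.lineMap_mem (supportPoint_mem hh _)
    (supportPoint_mem hh _) ⟨ht0.le, ht1.le⟩
  obtain ⟨h0, -, hcov⟩ := (mem_support_iff hh).1 hmem
  obtain ⟨i, hi⟩ := hcov j₂
  have hi₁ : (i : ℕ) ≤ j₁ := not_lt.1 fun hcon => hno i i.2 hcon hi.1
  rcases (imin_le i).eq_or_lt with hmin | hmin
  · rw [← Subtype.ext hmin] at hi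
    have h1 := hi.2 P.jmax (fst_le_jmax _)
    have h2 := hh P.imin i₀ j₂ P.jmax hi₀ (hi₀'.trans hlt.le)
      (lt_of_le_of_ne (le_jmax _) hne)
    dsimp only at h1
    rw [h0, hm] at h1
    simp only [supportPoint, if_pos (imin_le_snd j₂), if_pos (hi₀'.trans hlt.le)] at h1
    nlinarith
  · have h1 := hi.2 j₁ hi₁
    have h2 := ht i hmin hi₁
    dsimp only at h1
    linarith

end IJPair

/-! ### Dissections and difference inequalities -/

/-- For a weakly Monge array `c` and a non-crossing relation `D`, the system
`z s - z t ≤ c s t`, with equality on `D`, is solvable on every interval `[a, a + n]`, with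
equality at its end points. The interval is cut after the largest `p < a + n` with `D a p`, or
after `a`; then each pair in `D` other than `(a, a + n)` lies in one of the two parts. -/
theorem exists_potential {c : ℕ → ℕ → ℝ} {D : ℕ → ℕ → Prop} {N : ℕ} (hc : ∀ s, c s s = 0)
    (hM : ∀ s t u v, s < t → t ≤ u → u < v → v ≤ N → c s v + c t u ≤ c s u + c t v)
    (hD : ∀ s t u v, D s u → D t v → s < t → t ≤ u → ¬u < v) (n : ℕ) :
    ∀ a, a + n ≤ N → ∃ z : ℕ → ℝ, z a - z (a + n) = c a (a + n) ∧
      (∀ s t, a ≤ s → s ≤ t → t ≤ a + n → z s - z t ≤ c s t) ∧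
      ∀ s t, a ≤ s → s ≤ t → t ≤ a + n → D s t → z s - z t = c s t := by
  classical
  induction n using Nat.strong_induction_on with
  | _ n ih =>
    intro a hN
    rcases Nat.eq_zero_or_pos n with rfl | hn
    · have hst : ∀ s t, a ≤ s → s ≤ t → t ≤ a + 0 → s = t := fun s t _ _ _ => by omega
      refine ⟨0, by simp [hc], fun s t h1 h2 h3 => ?_, fun s t h1 h2 h3 _ => ?_⟩ <;>
        simp [hst s t h1 h2 h3, hc]
    obtain ⟨p, hp, hmax⟩ := Finset.exists_max_image
      ((Finset.Ico a (a + n)).filter fun t => t = a ∨ D a t) id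
      ⟨a, by simp [hn]⟩
    rw [Finset.mem_filter, Finset.mem_Ico] at hp
    obtain ⟨⟨hap, hpb⟩, hpD⟩ := hp
    have hsplit : ∀ s t, a ≤ s → t ≤ a + n → D s t → ¬(s = a ∧ t = a + n) → s ≤ p → t ≤ p := by
      intro s t hs ht hst hne hsp
      by_contra! hpt
      rcases hs.eq_or_lt with rfl | hs
      · have : t ≤ p := hmax t (by
          rw [Finset.mem_filter, Finset.mem_Ico]
          exact ⟨⟨by omega, by omega⟩, Or.inr hst⟩)
        omega
      · exact hD a s p t (hpD.resolve_left (by omega)) hst hs hsp hpt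
    obtain ⟨z₁, ha₁, hle₁, heq₁⟩ := ih (p - a) (by omega) a (by omega)
    obtain ⟨z₂, ha₂, hle₂, heq₂⟩ := ih (a + n - (p + 1)) (by omega) (p + 1) (by omega)
    rw [show a + (p - a) = p by omega] at ha₁ hle₁ heq₁
    rw [show p + 1 + (a + n - (p + 1)) = a + n by omega] at ha₂ hle₂ heq₂
    have hpn : ¬a + n ≤ p := by omega
    have hab : (if a ≤ p then z₁ a - z₁ a + c a (a + n) else z₂ a - z₂ (a + n))
        - (if a + n ≤ p then z₁ (a + n) - z₁ a + c a (a + n) else z₂ (a + n) - z₂ (a + n))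
        = c a (a + n) := by
      rw [if_pos hap, if_neg hpn]; ring
    refine ⟨fun s => if s ≤ p then z₁ s - z₁ a + c a (a + n) else z₂ s - z₂ (a + n),
      hab, fun s t hs hst ht => ?_, fun s t hs hst ht hDst => ?_⟩
    · by_cases htp : t ≤ p
      · simp only [if_pos htp, if_pos (hst.trans htp)]
        linarith [hle₁ s t hs hst htp]
      · by_cases hsp : s ≤ p
        · simp only [if_neg htp, if_pos hsp]
          have e1 := hle₁ s p hs hsp le_rfl
          have e2 := hle₂ (p + 1) t le_rfl (by omega) ht
          have e3 : c a (a + n) + c s p ≤ c a p + c s (a + n) := by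
            rcases hs.eq_or_lt with rfl | hs
            · linarith
            · exact hM a s p (a + n) hs hsp hpb hN
          have e4 : c s (a + n) + c (p + 1) t ≤ c s t + c (p + 1) (a + n) := by
            rcases ht.eq_or_lt with rfl | ht
            · linarith
            · exact hM s (p + 1) t (a + n) (by omega) (by omega) ht hN
          linarith
        · simp only [if_neg htp, if_neg hsp]
          linarith [hle₂ s t (by omega) hst ht]
    · by_cases hne : s = a ∧ t = a + n
      · obtain ⟨rfl, rfl⟩ := hne
        exact hab
      by_cases hsp : s ≤ p
      · have htp := hsplit s t hs ht hDst hne hsp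
        simp only [if_pos htp, if_pos hsp]
        linarith [heq₁ s t hs hst htp hDst]
      · have htp : ¬t ≤ p := by omega
        simp only [if_neg htp, if_neg hsp]
        linarith [heq₂ s t (by omega) hst ht hDst]

/-- A strictly Monge array remains weakly Monge after small perturbations. -/
theorem exists_monge_gap {c : ℕ → ℕ → ℝ} {N : ℕ}
    (hM : ∀ s t u v, s < t → t ≤ u → u < v → v ≤ N → c s v + c t u < c s u + c t v) :
    ∃ ε : ℝ, 0 < ε ∧ ∀ s t u v, s < t → t ≤ u → u < v → v ≤ N →
      c s v + c t u + 2 * ε ≤ c s u + c t v := by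
  have hev : ∀ᶠ ε in 𝓝[>] (0 : ℝ), ∀ q : Fin (N + 1) × Fin (N + 1) × Fin (N + 1) × Fin (N + 1),
      q.1 < q.2.1 → q.2.1 ≤ q.2.2.1 → q.2.2.1 < q.2.2.2 →
      c q.1 q.2.2.2 + c q.2.1 q.2.2.1 + 2 * ε ≤ c q.1 q.2.2.1 + c q.2.1 q.2.2.2 := by
    refine eventually_all.2 fun q => ?_
    by_cases hq : q.1 < q.2.1 ∧ q.2.1 ≤ q.2.2.1 ∧ q.2.2.1 < q.2.2.2
    · have h1 := hM q.1 q.2.1 q.2.2.1 q.2.2.2 hq.1 hq.2.1 hq.2.2 (by omega)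
      filter_upwards [Ioo_mem_nhdsGT (half_pos (sub_pos.2 h1))] with ε hε _ _ _
      linarith [hε.2]
    · exact Eventually.of_forall fun ε h1 h2 h3 => absurd ⟨h1, h2, h3⟩ hq
  obtain ⟨ε, hε, hpos⟩ := (hev.and self_mem_nhdsWithin).exists
  refine ⟨ε, hpos, fun s t u v hst htu huv hv => ?_⟩
  exact hε (⟨s, by omega⟩, ⟨t, by omega⟩, ⟨u, by omega⟩, ⟨v, by omega⟩) hst htu huv

section Model

variable {E : Type*} [NormedAddCommGroup E] [NormedSpace ℝ E]

/-- The inequality `Y s - Y t ≤ c s t` attached to the diagonal `(s, t + 1)` of the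
`(d + 3)`-gon. -/
def diagForm (d : ℕ) (c : ℕ → ℕ → ℝ) (Y : ℕ → E →ᵃ[ℝ] ℝ)
    (e : {e : Fin (d + 3) × Fin (d + 3) // IsDiagonal e}) : E →ᵃ[ℝ] ℝ :=
  Y e.1.1 - Y ((e.1.2 : ℕ) - 1) - AffineMap.const ℝ _ (c e.1.1 ((e.1.2 : ℕ) - 1))

variable {d : ℕ} {c : ℕ → ℕ → ℝ} {Y : ℕ → E →ᵃ[ℝ] ℝ} {S : AffineSubspace ℝ E}

theorem diagForm_apply (e : {e : Fin (d + 3) × Fin (d + 3) // IsDiagonal e}) (x : E) :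
    diagForm d c Y e x =
      Y e.1.1 x - Y ((e.1.2 : ℕ) - 1) x - c e.1.1 ((e.1.2 : ℕ) - 1) := by
  simp [diagForm]

theorem le_of_mem_polyhedron (hc : ∀ s, c s s = 0) (hc0 : c 0 (d + 1) = 0)
    (hY0 : ∀ x ∈ S, Y 0 x = 0 ∧ Y (d + 1) x = 0) {x : E}
    (hx : x ∈ polyhedron S (diagForm d c Y)) {s t : ℕ} (hst : s ≤ t) (ht : t ≤ d + 1) :
    Y s x - Y t x ≤ c s t := by
  rcases hst.eq_or_lt with rfl | hlt
  · simp [hc]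
  by_cases h0 : s = 0 ∧ t = d + 1
  · obtain ⟨rfl, rfl⟩ := h0
    obtain ⟨h1, h2⟩ := hY0 x hx.1
    rw [h1, h2, hc0, sub_zero]
  · have := hx.2 ⟨(⟨s, by omega⟩, ⟨t + 1, by omega⟩), by
      constructor <;> simp only <;> omega⟩
    rw [diagForm_apply] at this
    simp only [add_tsub_cancel_right] at this
    linarith

/-- Inequalities tight at a common point correspond to non-crossing diagonals, by the strict
Monge property. -/
theorem exists_dissection_eq_tight (hc : ∀ s, c s s = 0) (hc0 : c 0 (d + 1) = 0)
    (hM : ∀ s t u v, s < t → t ≤ u → u < v → v ≤ d + 1 → c s v + c t u < c s u + c t v)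
    (hY0 : ∀ x ∈ S, Y 0 x = 0 ∧ Y (d + 1) x = 0) {x : E}
    (hx : x ∈ polyhedron S (diagForm d c Y)) :
    ∃ D : Dissection (d + 3), tight (diagForm d c Y) x = {e | e.1 ∈ D.1} := by
  classical
  let D : Finset (Fin (d + 3) × Fin (d + 3)) := Finset.univ.filter fun e =>
    ∃ he : IsDiagonal e, diagForm d c Y ⟨e, he⟩ x = 0
  have hD : ∀ e, e ∈ D ↔ ∃ he : IsDiagonal e, diagForm d c Y ⟨e, he⟩ x = 0 := by simp [D]
  refine ⟨⟨D, fun e he => ((hD e).1 he).1, ?_⟩, ?_⟩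
  · rintro e he f hf ⟨h1, h2, h3⟩
    obtain ⟨he, he0⟩ := (hD e).1 he
    obtain ⟨hf, hf0⟩ := (hD f).1 hf
    rw [diagForm_apply] at he0 hf0
    dsimp only at he0 hf0
    rw [Fin.lt_def] at h1 h2 h3
    have e1 := hM e.1 f.1 (e.2 - 1) (f.2 - 1) h1 (by omega) (by omega) (by omega)
    have e2 := le_of_mem_polyhedron hc hc0 hY0 hx (s := e.1) (t := f.2 - 1) (by omega) (by omega)
    have e3 := le_of_mem_polyhedron hc hc0 hY0 hx (s := f.1) (t := e.2 - 1) (by omega) (by omega)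
    linarith
  · ext e
    change diagForm d c Y e x = 0 ↔ e.1 ∈ D
    rw [hD]
    exact ⟨fun h => ⟨e.2, h⟩, fun ⟨_, h⟩ => h⟩

/-- Every dissection is the set of tight inequalities at some point. Lowering `c` by a small `ε`
off the dissection keeps it weakly Monge, and a potential for the lowered array that is tight on
the dissection satisfies the other inequalities strictly. -/
theorem exists_tight_eq_dissection (hc : ∀ s, c s s = 0) (hc0 : c 0 (d + 1) = 0)
    (hM : ∀ s t u v, s < t → t ≤ u → u < v → v ≤ d + 1 → c s v + c t u < c s u + c t v)
    (hY : ∀ z : ℕ → ℝ, z 0 = 0 → z (d + 1) = 0 → ∃ x ∈ S, ∀ s ≤ d + 1, Y s x = z s)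
    (D : Dissection (d + 3)) :
    ∃ x ∈ polyhedron S (diagForm d c Y), tight (diagForm d c Y) x = {e | e.1 ∈ D.1} := by
  classical
  obtain ⟨ε, hε, hgap⟩ := exists_monge_gap hM
  let R : ℕ → ℕ → Prop := fun s t =>
    (s = 0 ∧ t = d + 1) ∨ ∃ e ∈ D.1, (e.1 : ℕ) = s ∧ (e.2 : ℕ) = t + 1
  have hR : ∀ s t u v, R s u → R t v → s < t → t ≤ u → ¬u < v := by
    rintro s t u v (⟨rfl, rfl⟩ | ⟨e, he, rfl, he2⟩) (⟨rfl, rfl⟩ | ⟨f, hf, rfl, hf2⟩) h1 h2 h3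
    · omega
    · omega
    · omega
    · refine D.2.2 e he f hf ⟨h1, ?_, ?_⟩ <;> rw [Fin.lt_def] <;> omega
  let c' : ℕ → ℕ → ℝ := fun s t => if R s t ∨ s = t then c s t else c s t - ε
  have hc'le : ∀ s t, c' s t ≤ c s t := fun s t => by
    simp only [c']; split_ifs <;> linarith
  have hc'ge : ∀ s t, c s t - ε ≤ c' s t := fun s t => by
    simp only [c']; split_ifs <;> linarith
  obtain ⟨z, hz0, hzle, hzeq⟩ := exists_potential (c := c') (D := R) (N := d + 1)
    (fun s => by simp [c', hc]) (fun s t u v h1 h2 h3 h4 => by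
      linarith [hgap s t u v h1 h2 h3 h4, hc'le s v, hc'le t u, hc'ge s u, hc'ge t v])
    hR (d + 1) 0 (by omega)
  rw [zero_add] at hz0 hzle hzeq
  have hz0' : z 0 = z (d + 1) := by
    have : c' 0 (d + 1) = 0 := by simp [c', R, hc0]
    linarith
  obtain ⟨x, hxS, hx⟩ := hY (fun s => z s - z (d + 1)) (by simp [hz0']) (by simp)
  have hform : ∀ e : {e : Fin (d + 3) × Fin (d + 3) // IsDiagonal e},
      diagForm d c Y e x ≤ 0 ∧ (diagForm d c Y e x = 0 ↔ e.1 ∈ D.1) := by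
    rintro ⟨e, he⟩
    have he1 := he.1
    have he2 := he.2
    have hs : (e.1 : ℕ) ≤ d + 1 := by omega
    have ht : (e.2 : ℕ) - 1 ≤ d + 1 := by omega
    have hle := hzle e.1 (e.2 - 1) (Nat.zero_le _) (by omega) ht
    rw [diagForm_apply]
    dsimp only
    rw [hx _ hs, hx _ ht]
    have hRD : R e.1 (e.2 - 1) ↔ e ∈ D.1 := by
      constructor
      · rintro (⟨h1, h2⟩ | ⟨f, hf, h1, h2⟩)
        · exact absurd ⟨h1, by omega⟩ he2
        · have : f = e := Prod.ext (Fin.ext h1) (Fin.ext (by omega))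
          rwa [← this]
      · exact fun h => Or.inr ⟨e, h, rfl, by omega⟩
    have hle' := hc'le e.1 (e.2 - 1)
    refine ⟨by linarith, fun h0 => ?_, fun h0 => ?_⟩
    · by_contra hcon
      have : c' e.1 (e.2 - 1) = c e.1 (e.2 - 1) - ε := by
        simp only [c']
        rw [if_neg]
        rintro (h1 | h1)
        · exact hcon (hRD.1 h1)
        · omega
      linarith
    · have h1 := hzeq e.1 (e.2 - 1) (Nat.zero_le _) (by omega) ht (hRD.2 h0)
      have : c' e.1 (e.2 - 1) = c e.1 (e.2 - 1) := by
        simp only [c']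
        rw [if_pos (Or.inl (hRD.2 h0))]
      linarith
  exact ⟨x, ⟨hxS, fun e => (hform e).1⟩, Set.ext fun e => (hform e).2⟩

/-- The difference inequalities of a strictly Monge array cut out a classical associahedron. -/
theorem isAssociahedron_of_monge [FiniteDimensional ℝ E] (hc : ∀ s, c s s = 0)
    (hc0 : c 0 (d + 1) = 0)
    (hM : ∀ s t u v, s < t → t ≤ u → u < v → v ≤ d + 1 → c s v + c t u < c s u + c t v)
    (hY0 : ∀ x ∈ S, Y 0 x = 0 ∧ Y (d + 1) x = 0)
    (hY : ∀ z : ℕ → ℝ, z 0 = 0 → z (d + 1) = 0 → ∃ x ∈ S, ∀ s ≤ d + 1, Y s x = z s)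
    (hb : Bornology.IsBounded (polyhedron S (diagForm d c Y)))
    (hd : Module.finrank ℝ S.direction = d) :
    IsAssociahedron d (polyhedron S (diagForm d c Y)) := by
  have hex := exists_tight_eq_dissection hc hc0 hM hY
  obtain ⟨x, hx, hxt⟩ := hex ⟨∅, by simp⟩
  refine ⟨isPolytope_polyhedron ⟨x, hx⟩ hb, ?_, ?_⟩
  · rw [vectorSpan_polyhedron hx (by simpa using hxt), hd]
  · refine nonempty_faces_orderIso S (diagForm d c Y)
      (fun D : Dissection (d + 3) => {e | e.1 ∈ D.1}) (fun D D' => ⟨fun h e he => ?_, ?_⟩) hex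
      (fun x hx => exists_dissection_eq_tight hc hc0 hM hY0 hx)
    · exact h (show (⟨e, D.2.1 e he⟩ : {e // IsDiagonal e}) ∈ {e | e.1 ∈ D.1} from he)
    · exact fun h e he => h he

end Model

namespace IJPair

variable {P : IJPair} {h : P.I → P.J → ℝ}

/-! ### The support without consecutive bars -/

/-- An increasing enumeration `κ 1, …, κ d` of `J̄' ∖ {max J̄}`, followed by
`κ (d + 1) = max J̄`. The value `κ 0` plays no role. -/
structure IsBarEnum (P : IJPair) (κ : ℕ → P.J) : Prop where
  lt : ∀ s t, 1 ≤ s → s < t → t ≤ P.innerJ.card + 1 → (κ s : ℕ) < κ t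
  mem : ∀ s, 1 ≤ s → s ≤ P.innerJ.card → (κ s : ℕ) ∈ P.innerJ
  surj : ∀ j : P.J, (j : ℕ) ∈ P.innerJ → ∃ s, 1 ≤ s ∧ s ≤ P.innerJ.card ∧ κ s = j
  last : κ (P.innerJ.card + 1) = P.jmax

theorem exists_isBarEnum (P : IJPair) : ∃ κ, IsBarEnum P κ := by
  let f := P.innerJ.orderEmbOfFin rfl
  have hf : ∀ s, (f s : ℕ) ∈ P.innerJ := fun s => P.innerJ.orderEmbOfFin_mem rfl s
  have hJ : ∀ {j}, j ∈ P.innerJ → j ∈ P.J := fun hj => (mem_innerJ.1 hj).2.1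
  have hval : ∀ s (h1 : 1 ≤ s) (h2 : s ≤ P.innerJ.card), s - 1 < P.innerJ.card := by omega
  let κ : ℕ → P.J := fun s => if hs : 1 ≤ s ∧ s ≤ P.innerJ.card then
    ⟨f ⟨s - 1, hval s hs.1 hs.2⟩, hJ (hf _)⟩ else P.jmax
  have hκ : ∀ s (h1 : 1 ≤ s) (h2 : s ≤ P.innerJ.card),
      (κ s : ℕ) = f ⟨s - 1, hval s h1 h2⟩ := fun s h1 h2 => by
    simp only [κ, dif_pos (And.intro h1 h2)]
  have hlast : κ (P.innerJ.card + 1) = P.jmax := by simp [κ]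
  refine ⟨κ, ⟨fun s t hs hst ht => ?_, fun s h1 h2 => hκ s h1 h2 ▸ hf _, fun j hj => ?_, hlast⟩⟩
  · rcases ht.eq_or_lt with rfl | ht
    · rw [hlast, hκ s hs (by omega)]
      have h1 := mem_innerJ.1 (hf ⟨s - 1, hval s hs (by omega)⟩)
      exact lt_of_le_of_ne (le_jmax ⟨_, h1.2.1⟩) h1.1
    · rw [hκ s hs (by omega), hκ t (by omega) (by omega)]
      exact f.strictMono (Fin.mk_lt_mk.2 (by omega))
  · have h1 : (j : ℕ) ∈ Set.range f := by
      rw [Finset.range_orderEmbOfFin]; exact hj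
    obtain ⟨s, hs⟩ := h1
    refine ⟨s + 1, by omega, by omega, Subtype.ext ?_⟩
    rw [hκ _ (by omega) (by omega), ← hs]
    rfl

theorem IsBarEnum.le {κ : ℕ → P.J} (hκ : IsBarEnum P κ) {s t : ℕ} (hs : 1 ≤ s) (hst : s ≤ t)
    (ht : t ≤ P.innerJ.card + 1) : (κ s : ℕ) ≤ κ t := by
  rcases hst.eq_or_lt with rfl | hst
  · exact le_rfl
  · exact (hκ.lt s t hs hst ht).le

/-- `τ s` is the last element of `I` before `κ s`, and `τ 0 = min I`. -/
structure IsLastPlain (P : IJPair) (κ : ℕ → P.J) (τ : ℕ → P.I) : Prop where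
  zero : τ 0 = P.imin
  le : ∀ s, 1 ≤ s → s ≤ P.innerJ.card → (τ s : ℕ) ≤ κ s
  max : ∀ s, 1 ≤ s → s ≤ P.innerJ.card → ∀ i : P.I, (i : ℕ) ≤ κ s → (i : ℕ) ≤ τ s

theorem exists_isLastPlain (κ : ℕ → P.J) : ∃ τ, IsLastPlain P κ τ := by
  have hex : ∀ s, ∃ i : P.I, (i : ℕ) ≤ κ s ∧ ∀ i' : P.I, (i' : ℕ) ≤ κ s → (i' : ℕ) ≤ i := by
    intro s
    obtain ⟨i, hi, hmax⟩ := Finset.exists_max_image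
      (Finset.univ.filter fun i : P.I => (i : ℕ) ≤ κ s) (fun i => (i : ℕ))
      ⟨P.imin, by simpa using imin_le_snd (κ s)⟩
    exact ⟨i, by simpa using hi, fun i' hi' => hmax i' (by simpa using hi')⟩
  choose τ hτ using hex
  exact ⟨fun s => if s = 0 then P.imin else τ s, by simp,
    fun s hs _ => by rw [if_neg (by omega)]; exact (hτ s).1,
    fun s hs _ => by rw [if_neg (by omega)]; exact (hτ s).2⟩

theorem IsLastPlain.imin_lt {κ : ℕ → P.J} {τ : ℕ → P.I} (hτ : IsLastPlain P κ τ)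
    (hκ : IsBarEnum P κ) {s : ℕ} (h1 : 1 ≤ s) (h2 : s ≤ P.innerJ.card) :
    (P.imin : ℕ) < τ s := by
  obtain ⟨-, -, i, hi, hi'⟩ := mem_innerJ.1 (hκ.mem s h1 h2)
  exact hi.trans_le (hτ.max s h1 h2 i hi')

/-- Without consecutive bars, each bar is the first one after the last preceding plain element. -/
theorem IsLastPlain.lt_of_lt {κ : ℕ → P.J} {τ : ℕ → P.I} (hτ : IsLastPlain P κ τ)
    (hκ : IsBarEnum P κ) (hno : ¬P.HasConsecutiveBars) {s t : ℕ} (hs : 1 ≤ s) (hst : s < t)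
    (ht : t ≤ P.innerJ.card) : (κ s : ℕ) < τ t := by
  rw [hasConsecutiveBars_iff] at hno
  push Not at hno
  obtain ⟨i, hi, h1, h2⟩ := hno _ (hκ.mem s hs (by omega)) _ (hκ.mem t (by omega) ht)
    (hκ.lt s t hs hst (by omega))
  exact h1.trans_le (hτ.max t (by omega) ht ⟨i, hi⟩ h2)

theorem IsLastPlain.lt {κ : ℕ → P.J} {τ : ℕ → P.I} (hτ : IsLastPlain P κ τ)
    (hκ : IsBarEnum P κ) (hno : ¬P.HasConsecutiveBars) {s t : ℕ} (hst : s < t)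
    (ht : t ≤ P.innerJ.card) : (τ s : ℕ) < τ t := by
  rcases Nat.eq_zero_or_pos s with rfl | hs
  · rw [hτ.zero]; exact hτ.imin_lt hκ (by omega) ht
  · exact (hτ.le s hs (by omega)).trans_lt (hτ.lt_of_lt hκ hno hs hst ht)

/-- The array `c(s,t) = g(τ s, κ t) - g(τ s, κ s)`, where `g(i,k) = h(i,k) - h(min I, k)`. -/
def barArray (h : P.I → P.J → ℝ) (κ : ℕ → P.J) (τ : ℕ → P.I) (s t : ℕ) : ℝ :=
  (h (τ s) (κ t) - h P.imin (κ t)) - (h (τ s) (κ s) - h P.imin (κ s))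

theorem barArray_monge (hh : P.NonCrossing h) {κ : ℕ → P.J} {τ : ℕ → P.I}
    (hκ : IsBarEnum P κ) (hτ : IsLastPlain P κ τ) (hno : ¬P.HasConsecutiveBars) (s t u v : ℕ)
    (hst : s < t) (htu : t ≤ u) (huv : u < v) (hv : v ≤ P.innerJ.card + 1) :
    barArray h κ τ s v + barArray h κ τ t u < barArray h κ τ s u + barArray h κ τ t v := by
  have := hh (τ s) (τ t) (κ u) (κ v) (hτ.lt hκ hno hst (by omega))
    ((hτ.le t (by omega) (by omega)).trans (hκ.le (by omega) htu (by omega)))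
    (hκ.lt u v (by omega) huv hv)
  unfold barArray
  linarith

/-- The subspace of the vectors supported on `J̄' ∖ {max J̄}`. -/
def innerSubmodule (P : IJPair) : Submodule ℝ (P.J → ℝ) where
  carrier := {v | ∀ j : P.J, (j : ℕ) ∉ P.innerJ → v j = 0}
  add_mem' := fun hv hw j hj => by rw [Pi.add_apply, hv j hj, hw j hj, add_zero]
  zero_mem' := fun _ _ => rfl
  smul_mem' := fun c v hv j hj => by rw [Pi.smul_apply, hv j hj, smul_zero]

theorem finrank_innerSubmodule (P : IJPair) :
    Module.finrank ℝ P.innerSubmodule = P.innerJ.card := by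
  let e : P.innerSubmodule ≃ₗ[ℝ] (P.innerJ → ℝ) :=
    { toFun := fun v j => v.1 ⟨j, (mem_innerJ.1 j.2).2.1⟩
      map_add' := fun _ _ => rfl
      map_smul' := fun _ _ => rfl
      invFun := fun f => ⟨fun j => if hj : (j : ℕ) ∈ P.innerJ then f ⟨j, hj⟩ else 0,
        fun j hj => dif_neg hj⟩
      left_inv := fun v => by
        ext j
        by_cases hj : (j : ℕ) ∈ P.innerJ
        · simp [hj]
        · simp [hj, v.2 j hj]
      right_inv := fun f => by ext j; simp }
  rw [e.finrank_eq, Module.finrank_fintype_fun_eq_card, Fintype.card_coe]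

/-- The affine subspace on which `min I` covers all `j̄` outside `J̄' ∖ {max J̄}`. -/
def innerSubspace (h : P.I → P.J → ℝ) : AffineSubspace ℝ (P.J → ℝ) :=
  AffineSubspace.mk' (fun j => h P.imin j - h P.imin P.jmax) P.innerSubmodule

theorem mem_innerSubspace {x : P.J → ℝ} : x ∈ innerSubspace h ↔
    ∀ j : P.J, (j : ℕ) ∉ P.innerJ → x j = h P.imin j - h P.imin P.jmax := by
  rw [innerSubspace, AffineSubspace.mem_mk']
  exact forall₂_congr fun j _ => sub_eq_zero

theorem jmax_notMem_innerJ : (P.jmax : ℕ) ∉ P.innerJ := fun hj => (mem_innerJ.1 hj).1 rfl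

/-- The slack at `κ s` of the bound that `min I` imposes; at `s = 0` it is `0` by convention, so
that `Y 0 - Y s ≤ 0` is this bound itself. -/
def slackForm (h : P.I → P.J → ℝ) (κ : ℕ → P.J) (s : ℕ) : (P.J → ℝ) →ᵃ[ℝ] ℝ :=
  if s = 0 then 0 else AffineMap.const ℝ _ (h P.imin (κ s) - h P.imin P.jmax) -
    (LinearMap.proj (R := ℝ) (φ := fun _ : P.J => ℝ) (κ s)).toAffineMap

theorem slackForm_zero (κ : ℕ → P.J) (x : P.J → ℝ) : slackForm h κ 0 x = 0 := by
  simp [slackForm]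

theorem slackForm_apply {s : ℕ} (hs : 1 ≤ s) (κ : ℕ → P.J) (x : P.J → ℝ) :
    slackForm h κ s x = h P.imin (κ s) - h P.imin P.jmax - x (κ s) := by
  simp [slackForm, show s ≠ 0 by omega]

theorem slackForm_last {κ : ℕ → P.J} (hκ : IsBarEnum P κ) {x : P.J → ℝ} (hx : x P.jmax = 0) :
    slackForm h κ (P.innerJ.card + 1) x = 0 := by
  rw [slackForm_apply (by omega), hκ.last, hx]; ring

theorem exists_slackForm_eq {κ : ℕ → P.J} (hκ : IsBarEnum P κ) (z : ℕ → ℝ) (hz0 : z 0 = 0)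
    (hz : z (P.innerJ.card + 1) = 0) :
    ∃ x ∈ innerSubspace h, ∀ s ≤ P.innerJ.card + 1, slackForm h κ s x = z s := by
  classical
  let x : P.J → ℝ := fun j => h P.imin j - h P.imin P.jmax -
    ∑ s ∈ Finset.Icc 1 P.innerJ.card, if κ s = j then z s else 0
  have hx : x ∈ innerSubspace h := mem_innerSubspace.2 fun j hj => by
    simp only [x]
    rw [Finset.sum_eq_zero, sub_zero]
    intro s hs
    rw [Finset.mem_Icc] at hs
    exact if_neg fun (he : κ s = j) => hj (he ▸ hκ.mem s hs.1 hs.2)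
  refine ⟨x, hx, fun s hs => ?_⟩
  rcases Nat.eq_zero_or_pos s with rfl | hpos
  · rw [slackForm_zero, hz0]
  rcases hs.eq_or_lt with rfl | hs
  · rw [slackForm_last hκ, hz]
    rw [mem_innerSubspace.1 hx _ jmax_notMem_innerJ, sub_self]
  · rw [slackForm_apply hpos, sub_sub_cancel, Finset.sum_eq_single s, if_pos rfl]
    · intro t ht hne
      rw [Finset.mem_Icc] at ht
      refine if_neg fun he => ?_
      rcases lt_or_gt_of_ne hne with hlt | hlt
      · exact (hκ.lt t s ht.1 hlt (by omega)).ne (by rw [he])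
      · exact (hκ.lt s t hpos hlt (by omega)).ne (by rw [he])
    · intro hcon
      exact absurd (Finset.mem_Icc.2 ⟨hpos, by omega⟩) hcon

/-- Without consecutive bars the support is cut out by the difference inequalities of `barArray`.
Among the arcs that may cover `κ s`, the one from `τ s` imposes the weakest conditions, and these
concern larger bars only. -/
theorem support_eq_polyhedron (hh : P.NonCrossing h) {κ : ℕ → P.J} {τ : ℕ → P.I}
    (hκ : IsBarEnum P κ) (hτ : IsLastPlain P κ τ) (hno : ¬P.HasConsecutiveBars) :
    P.support h = polyhedron (innerSubspace h)
      (diagForm P.innerJ.card (barArray h κ τ) (slackForm h κ)) := by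
  ext x
  rw [mem_support_iff hh]
  constructor
  · intro hx
    have h0 := hx.1
    refine ⟨mem_innerSubspace.2 fun j hj => ?_, ?_⟩
    · by_cases hjm : j = P.jmax
      · rw [hjm, h0, sub_self]
      obtain ⟨i, hi⟩ := hx.2.2 j
      rcases (imin_le i).eq_or_lt with hmin | hmin
      · rw [← Subtype.ext hmin] at hi
        have h1 := hi.2 P.jmax (fst_le_jmax _)
        have h2 := hx.le_height j
        rw [h0] at h1
        dsimp only at h1
        linarith
      · exact absurd (mem_innerJ.2 ⟨fun he => hjm (Subtype.ext he), j.2, i, hmin, hi.1⟩) hj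
    · rintro ⟨⟨s, t⟩, he1, he2⟩
      rw [diagForm_apply]
      dsimp only at he1 he2 ⊢
      rw [slackForm_apply (s := t - 1) (by omega)]
      rcases Nat.eq_zero_or_pos (s : ℕ) with hs | hs
      · rw [hs, slackForm_zero]
        simp only [barArray, hτ.zero]
        linarith [hx.le_height (κ (t - 1))]
      · rw [slackForm_apply hs]
        have hlt := hκ.lt s (t - 1) hs (by omega) (by omega)
        obtain ⟨i, hi⟩ := hx.2.2 (κ s)
        have h1 := hi.2 (κ (t - 1)) (hi.1.trans hlt.le)
        have h2 := hh.le (hτ.max s hs (by omega) i hi.1) (hτ.le s hs (by omega)) hlt.le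
        unfold barArray
        dsimp only at h1
        linarith
  · intro hx
    have hS := mem_innerSubspace.1 hx.1
    have h0 : x P.jmax = 0 := by rw [hS _ jmax_notMem_innerJ, sub_self]
    have hle : ∀ s t, s ≤ t → t ≤ P.innerJ.card + 1 →
        slackForm h κ s x - slackForm h κ t x ≤ barArray h κ τ s t := fun s t hst ht =>
      le_of_mem_polyhedron (fun s => by simp [barArray]) (by simp [barArray, hτ.zero])
        (fun x hx => ⟨slackForm_zero κ x, slackForm_last hκ (by
          rw [mem_innerSubspace.1 hx _ jmax_notMem_innerJ, sub_self])⟩) hx hst ht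
    have hheight : ∀ k, x k ≤ h P.imin k - h P.imin P.jmax := by
      intro k
      by_cases hk : (k : ℕ) ∈ P.innerJ
      · obtain ⟨t, ht1, ht2, rfl⟩ := hκ.surj k hk
        have h1 := hle 0 t (by omega) (by omega)
        rw [slackForm_zero, slackForm_apply ht1] at h1
        simp only [barArray, hτ.zero] at h1
        linarith
      · exact (hS k hk).le
    refine ⟨h0, ⟨imin_le_snd _, fun k _ => ?_⟩, fun j => ?_⟩
    · have := hheight k
      rw [h0]
      dsimp only
      linarith
    by_cases hj : (j : ℕ) ∈ P.innerJ
    · obtain ⟨s, hs1, hs2, rfl⟩ := hκ.surj j hj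
      refine ⟨τ s, hτ.le s hs1 hs2, fun k (hk : (τ s : ℕ) ≤ k) => ?_⟩
      obtain ⟨t, ht1, ht2, rfl⟩ : ∃ t, 1 ≤ t ∧ t ≤ P.innerJ.card + 1 ∧ κ t = k := by
        by_cases hkm : k = P.jmax
        · exact ⟨_, by omega, le_rfl, hκ.last.trans hkm.symm⟩
        · obtain ⟨t, h1, h2, h3⟩ := hκ.surj k (mem_innerJ.2
            ⟨fun he => hkm (Subtype.ext he), k.2, τ s, hτ.imin_lt hκ hs1 hs2, hk⟩)
          exact ⟨t, h1, by omega, h3⟩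
      have hst : s ≤ t := by
        by_contra! hts
        exact absurd (hτ.lt_of_lt hκ hno ht1 hts hs2) (not_lt.2 hk)
      have h1 := hle s t hst ht2
      rw [slackForm_apply hs1, slackForm_apply ht1] at h1
      unfold barArray at h1
      dsimp only
      linarith
    · refine ⟨P.imin, imin_le_snd j, fun k _ => ?_⟩
      have := hheight k
      have := hS j hj
      dsimp only
      linarith

theorem convex_support (hh : P.NonCrossing h) (hno : ¬P.HasConsecutiveBars) :
    Convex ℝ (P.support h) := by
  obtain ⟨κ, hκ⟩ := exists_isBarEnum P
  obtain ⟨τ, hτ⟩ := exists_isLastPlain κ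
  rw [support_eq_polyhedron hh hκ hτ hno]
  exact convex_polyhedron _ _

theorem isAssociahedron_support (hh : P.NonCrossing h) (hno : ¬P.HasConsecutiveBars) :
    IsAssociahedron P.innerJ.card (P.support h) := by
  obtain ⟨κ, hκ⟩ := exists_isBarEnum P
  obtain ⟨τ, hτ⟩ := exists_isLastPlain κ
  have hb : Bornology.IsBounded (P.support h) :=
    (isBounded_isCovered h).subset fun x hx => (mem_support_iff hh).1 hx
  rw [support_eq_polyhedron hh hκ hτ hno] at hb ⊢
  refine isAssociahedron_of_monge (fun s => by simp [barArray]) (by simp [barArray, hτ.zero])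
    (barArray_monge hh hκ hτ hno) (fun x hx => ⟨slackForm_zero κ x, slackForm_last hκ ?_⟩)
    (exists_slackForm_eq hκ) hb ?_
  · rw [mem_innerSubspace.1 hx _ jmax_notMem_innerJ, sub_self]
  · rw [innerSubspace, AffineSubspace.direction_mk', finrank_innerSubmodule]

end IJPair

/-! ### Lattice paths -/

/-- The step read at a node. -/
def stepOf (v : Node) : Step := if (ofLex v).2 then Step.N else Step.E

@[simp] theorem stepOf_plain (i : ℕ) : stepOf (plain i) = Step.E := rfl

@[simp] theorem stepOf_bar (j : ℕ) : stepOf (bar j) = Step.N := rfl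

theorem exists_eq_plain {v : Node} (hv : stepOf v = Step.E) : ∃ i, v = plain i := by
  obtain ⟨i, b⟩ := v
  cases b
  · exact ⟨i, rfl⟩
  · exact absurd (show Step.N = Step.E from hv) (by decide)

theorem exists_eq_bar {v : Node} (hv : stepOf v = Step.N) : ∃ j, v = bar j := by
  obtain ⟨i, b⟩ := v
  cases b
  · exact absurd (show Step.E = Step.N from hv) (by decide)
  · exact ⟨i, rfl⟩

theorem sort_eq_of_pairwise {s : Finset Node} {l : List Node} (hl : l.Pairwise (· < ·))
    (hs : ∀ v, v ∈ l ↔ v ∈ s) : s.sort (· ≤ ·) = l := by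
  have h1 : l.toFinset = s := by ext v; simp [hs]
  have hnd : l.Nodup := hl.imp fun h => h.ne
  rw [← h1]
  exact (List.toFinset_sort (· ≤ ·) hnd).2 (hl.imp fun h => h.le)

theorem hasNonInitialNN_map_iff {M : List Node} (hM : M.Pairwise (· < ·)) :
    HasNonInitialNN (M.map stepOf) ↔
      ∃ j₁ j₂ i, bar j₁ ∈ M ∧ bar j₂ ∈ M ∧ plain i ∈ M ∧ plain i < bar j₁ ∧ bar j₁ < bar j₂ ∧
        ∀ u ∈ M, ¬(bar j₁ < u ∧ u < bar j₂) := by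
  constructor
  · rintro ⟨α, β, hM', hE⟩
    obtain ⟨A, B, rfl, rfl, hB⟩ := List.map_eq_append_iff.1 hM'
    obtain ⟨v, C, rfl, hv, hC⟩ := List.map_eq_cons_iff.1 hB
    obtain ⟨w, D, rfl, hw, -⟩ := List.map_eq_cons_iff.1 hC
    obtain ⟨p, hp, hpE⟩ := List.mem_map.1 hE
    obtain ⟨j₁, rfl⟩ := exists_eq_bar hv
    obtain ⟨j₂, rfl⟩ := exists_eq_bar hw
    obtain ⟨i, rfl⟩ := exists_eq_plain hpE
    simp only [List.pairwise_append, List.pairwise_cons, List.mem_cons] at hM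
    obtain ⟨-, ⟨h1, h2, -⟩, h3⟩ := hM
    refine ⟨j₁, j₂, i, by simp, by simp, by simp [hp], h3 _ hp _ (Or.inl rfl),
      h1 _ (Or.inl rfl), fun u hu => ?_⟩
    rintro ⟨hu1, hu2⟩
    simp only [List.mem_append, List.mem_cons] at hu
    rcases hu with hu | rfl | rfl | hu
    · exact lt_asymm hu1 (h3 _ hu _ (Or.inl rfl))
    · exact lt_irrefl _ hu1
    · exact lt_irrefl _ hu2
    · exact lt_asymm hu2 (h2 _ hu)
  · rintro ⟨j₁, j₂, i, h₁, h₂, hi, hlt₁, hlt₂, hno⟩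
    obtain ⟨A, B, rfl⟩ := List.append_of_mem h₁
    simp only [List.pairwise_append, List.pairwise_cons, List.mem_cons] at hM
    obtain ⟨-, ⟨h3, h4⟩, h5⟩ := hM
    simp only [List.mem_append, List.mem_cons] at h₂ hi
    have hiA : plain i ∈ A := by
      rcases hi with hi | hi | hi
      · exact hi
      · exact absurd hlt₁ (hi ▸ lt_irrefl _)
      · exact absurd hlt₁ (lt_asymm (h3 _ hi))
    have h₂B : bar j₂ ∈ B := by
      rcases h₂ with h₂ | h₂ | h₂
      · exact absurd hlt₂ (lt_asymm (h5 _ h₂ _ (Or.inl rfl)))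
      · exact absurd hlt₂ (h₂ ▸ lt_irrefl _)
      · exact h₂
    cases B with
    | nil => simp at h₂B
    | cons w C =>
      have hw : w = bar j₂ := by
        rcases List.mem_cons.1 h₂B with h | h
        · exact h.symm
        · exact absurd ⟨h3 w (by simp), (List.pairwise_cons.1 h4).1 _ h⟩ (hno w (by simp))
      subst hw
      exact ⟨A.map stepOf, C.map stepOf, by simp, List.mem_map.2 ⟨_, hiA, rfl⟩⟩

open Classical in
theorem nonInitialNorth_map {M : List Node} (hM : M.Pairwise (· < ·)) :
    nonInitialNorth (M.map stepOf) =
      (M.filter fun v => stepOf v = Step.N ∧ ∃ i, plain i ∈ M ∧ plain i < v).length := by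
  induction M with
  | nil => rfl
  | cons a M ih =>
    obtain ⟨ha, hM⟩ := List.pairwise_cons.1 hM
    have hna : ¬∃ i, plain i ∈ a :: M ∧ plain i < a := by
      rintro ⟨i, hi, hlt⟩
      rcases List.mem_cons.1 hi with h | h
      · exact lt_irrefl _ (h ▸ hlt)
      · exact lt_asymm hlt (ha _ h)
    rw [List.filter_cons_of_neg (fun hcon => hna (of_decide_eq_true hcon).2)]
    cases hs : stepOf a with
    | N =>
      have h1 : nonInitialNorth ((a :: M).map stepOf) = nonInitialNorth (M.map stepOf) := by
        simp [nonInitialNorth, hs]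
      rw [h1, ih hM]
      congr 1
      refine List.filter_congr fun v hv => ?_
      have : ∀ i, plain i ≠ a := fun i he => by simp [← he] at hs
      simp [this]
    | E =>
      obtain ⟨i, rfl⟩ := exists_eq_plain hs
      have h1 : nonInitialNorth ((plain i :: M).map stepOf) = (M.map stepOf).count Step.N := by
        simp [nonInitialNorth]
      rw [h1, List.count, List.countP_map, List.countP_eq_length_filter]
      congr 1
      refine List.filter_congr fun v hv => ?_
      have : ∃ k, plain k ∈ plain i :: M ∧ plain k < v := ⟨i, by simp, ha v hv⟩
      rw [Bool.eq_iff_iff]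
      simp only [this, and_true]
      simp

namespace IJPair

variable {P : IJPair} {h : P.I → P.J → ℝ}

/-- The nodes read by the lattice path, in increasing order. -/
def pathNodes (P : IJPair) : List Node :=
  (((nodes P.I P.J).erase (plain P.imin)).erase (bar P.jmax)).sort (· ≤ ·)

theorem pairwise_pathNodes (P : IJPair) : P.pathNodes.Pairwise (· < ·) :=
  (Finset.sortedLT_sort _).pairwise

theorem mem_pathNodes {v : Node} :
    v ∈ P.pathNodes ↔ v ≠ bar P.jmax ∧ v ≠ plain P.imin ∧ v ∈ nodes P.I P.J := by
  simp [pathNodes]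

theorem plain_mem_pathNodes {i : ℕ} : plain i ∈ P.pathNodes ↔ i ∈ P.I ∧ (P.imin : ℕ) < i := by
  rw [mem_pathNodes, plain_mem_nodes]
  constructor
  · rintro ⟨-, h1, h2⟩
    exact ⟨h2, lt_of_le_of_ne (imin_le ⟨i, h2⟩) fun he => h1 (by rw [he])⟩
  · rintro ⟨h1, h2⟩
    exact ⟨by simp [plain, bar], fun he => (plain_lt_plain.2 h2).ne he.symm, h1⟩

theorem bar_mem_pathNodes {j : ℕ} : bar j ∈ P.pathNodes ↔ j ∈ P.J ∧ j ≠ P.jmax := by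
  rw [mem_pathNodes, bar_mem_nodes]
  simp [plain, bar, and_comm]

theorem path_eq (P : IJPair) : P.path = P.pathNodes.map stepOf := by
  have h1 : (nodes P.I P.J).sort (· ≤ ·) =
      plain P.imin :: (P.pathNodes ++ [bar P.jmax]) := by
    refine sort_eq_of_pairwise ?_ fun v => ?_
    · simp only [List.pairwise_cons, List.pairwise_append, List.mem_append, List.mem_singleton]
      refine ⟨?_, P.pairwise_pathNodes, by simp, ?_⟩
      · rintro v (hv | rfl)
        · obtain ⟨-, h2, h3⟩ := mem_pathNodes.1 hv
          rcases mem_nodes.1 h3 with ⟨i, hi, rfl⟩ | ⟨j, hj, rfl⟩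
          · exact plain_lt_plain.2 (plain_mem_pathNodes.1 hv).2
          · exact (plain_lt_bar _ _).2 (imin_le_snd ⟨j, hj⟩)
        · exact (plain_lt_bar _ _).2 (imin_le_snd _)
      · rintro v hv w rfl
        obtain ⟨-, h2, h3⟩ := mem_pathNodes.1 hv
        rcases mem_nodes.1 h3 with ⟨i, hi, rfl⟩ | ⟨j, hj, rfl⟩
        · exact (plain_lt_bar _ _).2 (fst_le_jmax ⟨i, hi⟩)
        · exact bar_lt_bar.2 (lt_of_le_of_ne (le_jmax ⟨j, hj⟩) (bar_mem_pathNodes.1 hv).2)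
    · simp only [List.mem_cons, List.mem_append, List.not_mem_nil, or_false]
      constructor
      · rintro (rfl | hv | rfl)
        exacts [plain_mem_nodes.2 P.imin.2, (mem_pathNodes.1 hv).2.2, bar_mem_nodes.2 P.jmax.2]
      · intro hv
        by_cases h1 : v = plain P.imin
        · exact Or.inl h1
        by_cases h2 : v = bar P.jmax
        · exact Or.inr (Or.inr h2)
        exact Or.inr (Or.inl (mem_pathNodes.2 ⟨h2, h1, hv⟩))
  rw [path, h1]
  simp [stepOf]

theorem hasConsecutiveBars_iff_path : P.HasConsecutiveBars ↔ HasNonInitialNN P.path := by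
  rw [path_eq, hasNonInitialNN_map_iff P.pairwise_pathNodes]
  constructor
  · rintro ⟨j₁, j₂, h₁, h₂, hlt, hno⟩
    obtain ⟨hm₁, hJ₁, i, hi, hij⟩ := mem_innerJ.1 (bar_mem_nodes.1 h₁)
    obtain ⟨hm₂, hJ₂, -⟩ := mem_innerJ.1 (bar_mem_nodes.1 h₂)
    refine ⟨j₁, j₂, i, bar_mem_pathNodes.2 ⟨hJ₁, hm₁⟩, bar_mem_pathNodes.2 ⟨hJ₂, hm₂⟩,
      plain_mem_pathNodes.2 ⟨i.2, hi⟩, (plain_lt_bar _ _).2 hij, hlt, fun u hu hb => ?_⟩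
    refine hno u ?_ hb
    rcases mem_nodes.1 (mem_pathNodes.1 hu).2.2 with ⟨k, hk, rfl⟩ | ⟨k, hk, rfl⟩
    · exact plain_mem_nodes.2 hk
    · exact bar_mem_nodes.2 (mem_innerJ.2 ⟨(bar_mem_pathNodes.1 hu).2, hk, i, hi,
        hij.trans (bar_lt_bar.1 hb.1).le⟩)
  · rintro ⟨j₁, j₂, i, h₁, h₂, hi, hij, hlt, hno⟩
    rw [bar_mem_pathNodes] at h₁ h₂
    rw [plain_mem_pathNodes] at hi
    rw [plain_lt_bar] at hij
    rw [bar_lt_bar] at hlt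
    refine hasConsecutiveBars_iff.2 ⟨j₁, mem_innerJ.2 ⟨h₁.2, h₁.1, ⟨i, hi.1⟩, hi.2, hij⟩,
      j₂, mem_innerJ.2 ⟨h₂.2, h₂.1, ⟨i, hi.1⟩, hi.2, hij.trans hlt.le⟩, hlt,
      fun k hk h3 h4 => ?_⟩
    exact hno _ (plain_mem_pathNodes.2 ⟨hk, (imin_le_snd ⟨j₁, h₁.1⟩).trans_lt h3⟩)
      ⟨(bar_lt_plain _ _).2 h3, (plain_lt_bar _ _).2 h4⟩

theorem nonInitialNorth_path (P : IJPair) : nonInitialNorth P.path = P.innerJ.card := by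
  classical
  have hinj : Function.Injective bar := fun a b hab => by simpa [bar] using hab
  rw [path_eq, nonInitialNorth_map P.pairwise_pathNodes, ← Finset.card_image_of_injective _ hinj,
    ← List.toFinset_card_of_nodup ((P.pairwise_pathNodes.imp fun h => h.ne).filter _)]
  congr 1
  ext v
  simp only [List.mem_toFinset, List.mem_filter, decide_eq_true_eq, Finset.mem_image]
  constructor
  · rintro ⟨hv, hN, i, hi, hlt⟩
    obtain ⟨j, rfl⟩ := exists_eq_bar hN
    rw [bar_mem_pathNodes] at hv
    rw [plain_mem_pathNodes] at hi
    exact ⟨j, mem_innerJ.2 ⟨hv.2, hv.1, ⟨i, hi.1⟩, hi.2, (plain_lt_bar _ _).1 hlt⟩, rfl⟩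
  · rintro ⟨j, hj, rfl⟩
    obtain ⟨hm, hJ, i, hi, hij⟩ := mem_innerJ.1 hj
    exact ⟨bar_mem_pathNodes.2 ⟨hJ, hm⟩, rfl, i, plain_mem_pathNodes.2 ⟨i.2, hi⟩,
      (plain_lt_bar _ _).2 hij⟩

end IJPair

/-- The nodes at positions `k, k + 1, …` whose steps are those of a given path. -/
def nodesFrom : ℕ → List Step → List Node
  | _, [] => []
  | k, Step.N :: ν => bar k :: nodesFrom (k + 1) ν
  | k, Step.E :: ν => plain k :: nodesFrom (k + 1) ν

theorem map_nodesFrom (ν : List Step) : ∀ k, (nodesFrom k ν).map stepOf = ν := by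
  induction ν with
  | nil => exact fun _ => rfl
  | cons s ν ih => intro k; cases s <;> simp [nodesFrom, ih]

theorem bounds_of_mem_nodesFrom (ν : List Step) :
    ∀ k, ∀ v ∈ nodesFrom k ν, k ≤ (ofLex v).1 ∧ (ofLex v).1 < k + ν.length := by
  induction ν with
  | nil => intro k v hv; simp [nodesFrom] at hv
  | cons s ν ih =>
    intro k v hv
    rw [List.length_cons]
    cases s <;> rcases List.mem_cons.1 hv with rfl | hv
    all_goals first
      | exact ⟨le_rfl, by change k < _; omega⟩
      | have := ih _ v hv
        omega

theorem pairwise_nodesFrom (ν : List Step) : ∀ k, (nodesFrom k ν).Pairwise (· < ·) := by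
  induction ν with
  | nil => exact fun _ => List.Pairwise.nil
  | cons s ν ih =>
    intro k
    cases s <;> refine List.pairwise_cons.2 ⟨fun v hv => ?_, ih _⟩ <;>
      exact Prod.Lex.lt_iff.2 (Or.inl (bounds_of_mem_nodesFrom ν _ v hv).1)

theorem exists_path_eq (ν : List Step) : ∃ P : IJPair, P.path = ν := by
  classical
  have hb := bounds_of_mem_nodesFrom ν 1
  let I : Finset ℕ := insert 0 ((Finset.range (ν.length + 1)).filter
    fun i => plain i ∈ nodesFrom 1 ν)
  let J : Finset ℕ := insert (ν.length + 1) ((Finset.range (ν.length + 1)).filter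
    fun j => bar j ∈ nodesFrom 1 ν)
  have hI : I.Nonempty := ⟨0, Finset.mem_insert_self _ _⟩
  have hJ : J.Nonempty := ⟨_, Finset.mem_insert_self _ _⟩
  let P : IJPair :=
    { I := I
      J := J
      hI := hI
      hJ := hJ
      min_le := (I.min'_le 0 (Finset.mem_insert_self _ _)).trans (Nat.zero_le _)
      max_le := by
        refine le_trans (I.max'_le _ _ fun i hi => ?_) (J.le_max' _ (Finset.mem_insert_self _ _))
        rcases Finset.mem_insert.1 hi with rfl | hi
        · omega
        · have := Finset.mem_range.1 (Finset.mem_filter.1 hi).1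
          omega }
  refine ⟨P, ?_⟩
  have hsort : (IJPair.nodes P.I P.J).sort (· ≤ ·) =
      plain 0 :: (nodesFrom 1 ν ++ [bar (ν.length + 1)]) := by
    refine sort_eq_of_pairwise ?_ fun v => ?_
    · simp only [List.pairwise_cons, List.pairwise_append, List.mem_append, List.mem_singleton]
      refine ⟨?_, pairwise_nodesFrom ν 1, by simp, ?_⟩
      · rintro v (hv | rfl)
        · exact Prod.Lex.lt_iff.2 (Or.inl (hb v hv).1)
        · exact (plain_lt_bar _ _).2 (Nat.zero_le _)
      · rintro v hv w rfl
        have := (hb v hv).2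
        exact Prod.Lex.lt_iff.2 (Or.inl (by change _ < ν.length + 1; omega))
    · rw [IJPair.mem_nodes]
      simp only [List.mem_cons, List.mem_append, List.not_mem_nil, or_false, P, I, J,
        Finset.mem_insert, Finset.mem_filter, Finset.mem_range]
      constructor
      · rintro (rfl | hv | rfl)
        · exact Or.inl ⟨0, Or.inl rfl, rfl⟩
        · have hlt := (hb v hv).2
          cases hs : stepOf v with
          | N =>
            obtain ⟨j, rfl⟩ := exists_eq_bar hs
            change j < _ at hlt
            exact Or.inr ⟨j, Or.inr ⟨by omega, hv⟩, rfl⟩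
          | E =>
            obtain ⟨i, rfl⟩ := exists_eq_plain hs
            change i < _ at hlt
            exact Or.inl ⟨i, Or.inr ⟨by omega, hv⟩, rfl⟩
        · exact Or.inr ⟨_, Or.inl rfl, rfl⟩
      · rintro (⟨i, rfl | ⟨-, hi⟩, rfl⟩ | ⟨j, rfl | ⟨-, hj⟩, rfl⟩)
        exacts [Or.inl rfl, Or.inr (Or.inl hi), Or.inr (Or.inr rfl), Or.inr (Or.inl hj)]
  rw [IJPair.path, hsort, List.tail_cons, List.dropLast_concat]
  exact map_nodesFrom ν 1

theorem fussCatalanPath_succ (m n : ℕ) : fussCatalanPath m (n + 1) =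
    Step.N :: (List.replicate m Step.E ++ fussCatalanPath m n) := by
  simp [fussCatalanPath, List.replicate_succ]

theorem count_fussCatalanPath (m n : ℕ) : (fussCatalanPath m n).count Step.N = n := by
  induction n with
  | zero => rfl
  | succ n ih => simp [fussCatalanPath_succ, ih, List.count_replicate]

theorem nonInitialNorth_fussCatalanPath {m n : ℕ} (hm : 1 ≤ m) (hn : 1 ≤ n) :
    nonInitialNorth (fussCatalanPath m n) = n - 1 := by
  obtain ⟨m, rfl⟩ := Nat.exists_eq_add_of_le' hm
  obtain ⟨n, rfl⟩ := Nat.exists_eq_add_of_le' hn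
  rw [fussCatalanPath_succ]
  simp [nonInitialNorth, List.replicate_succ, List.count_replicate, count_fussCatalanPath]

theorem not_hasNonInitialNN_fussCatalanPath {m : ℕ} (hm : 1 ≤ m) (n : ℕ) :
    ¬HasNonInitialNN (fussCatalanPath m n) := by
  have hrep : ∀ k l, List.IsChain (fun a b => ¬(a = Step.N ∧ b = Step.N)) l →
      List.IsChain (fun a b => ¬(a = Step.N ∧ b = Step.N)) (List.replicate k Step.E ++ l) := by
    intro k l hl
    induction k with
    | zero => exact hl
    | succ k ih =>
      rw [List.replicate_succ, List.cons_append, List.isChain_cons]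
      exact ⟨fun y _ => by simp, ih⟩
  have hchain : List.IsChain (fun a b => ¬(a = Step.N ∧ b = Step.N)) (fussCatalanPath m n) := by
    obtain ⟨m, rfl⟩ := Nat.exists_eq_add_of_le' hm
    induction n with
    | zero => exact List.IsChain.nil
    | succ n ih =>
      rw [fussCatalanPath_succ, List.isChain_cons]
      refine ⟨fun y hy => ?_, hrep _ _ ih⟩
      have : y = Step.E := by simpa [List.replicate_succ, eq_comm] using hy
      simp [this]
  rintro ⟨α, β, heq, -⟩
  rw [heq, List.isChain_append, List.isChain_cons_cons] at hchain
  exact hchain.2.1.1 ⟨rfl, rfl⟩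

end NuAsso

theorem mainTheorem7 :
    -- pairs `(I, J̄)`
    (∀ (P : NuAsso.IJPair) (h : P.I → P.J → ℝ), P.NonCrossing h →
      (Convex ℝ (P.support h) ↔ ¬P.HasConsecutiveBars) ∧
      (¬P.HasConsecutiveBars ↔ ¬NuAsso.HasNonInitialNN P.path) ∧
      (¬P.HasConsecutiveBars →
        NuAsso.IsRegularSubdivision (P.asso h) (P.support h) ∧
        NuAsso.IsAssociahedron P.innerJ.card (P.support h))) ∧
    -- lattice paths `ν`
    (∀ ν : List NuAsso.Step,
      (∃ P : NuAsso.IJPair, P.path = ν) ∧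
      ∀ P : NuAsso.IJPair, P.path = ν → ∀ h : P.I → P.J → ℝ, P.NonCrossing h →
        (Convex ℝ (P.support h) ↔ ¬NuAsso.HasNonInitialNN ν) ∧
        (¬NuAsso.HasNonInitialNN ν →
          NuAsso.IsRegularSubdivision (P.asso h) (P.support h) ∧
          NuAsso.IsAssociahedron (NuAsso.nonInitialNorth ν) (P.support h))) ∧
    -- `m`-associahedra
    (∀ m n : ℕ, 1 ≤ m → 1 ≤ n →
      ∀ P : NuAsso.IJPair, P.path = NuAsso.fussCatalanPath m n →
        ∀ h : P.I → P.J → ℝ, P.NonCrossing h →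
          Convex ℝ (P.support h) ∧
          NuAsso.IsRegularSubdivision (P.asso h) (P.support h) ∧
          NuAsso.IsAssociahedron (n - 1) (P.support h)) := by

  have main : ∀ (P : NuAsso.IJPair) (h : P.I → P.J → ℝ), P.NonCrossing h →
      (Convex ℝ (P.support h) ↔ ¬P.HasConsecutiveBars) ∧
      (¬P.HasConsecutiveBars ↔ ¬NuAsso.HasNonInitialNN P.path) ∧
      (¬P.HasConsecutiveBars →
        NuAsso.IsRegularSubdivision (P.asso h) (P.support h) ∧
        NuAsso.IsAssociahedron P.innerJ.card (P.support h)) := fun P h hh =>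
    ⟨⟨fun hconv hc => NuAsso.IJPair.not_convex_of_hasConsecutiveBars hh hc hconv,
      NuAsso.IJPair.convex_support hh⟩, not_congr NuAsso.IJPair.hasConsecutiveBars_iff_path,
      fun hno => ⟨NuAsso.IJPair.isRegularSubdivision_asso hh
        (NuAsso.IJPair.convex_support hh hno) (NuAsso.IJPair.support_nonempty hh),
        NuAsso.IJPair.isAssociahedron_support hh hno⟩⟩
  have paths : ∀ (P : NuAsso.IJPair) (ν : List NuAsso.Step), P.path = ν →
      ∀ h : P.I → P.J → ℝ, P.NonCrossing h →
        (Convex ℝ (P.support h) ↔ ¬NuAsso.HasNonInitialNN ν) ∧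
        (¬NuAsso.HasNonInitialNN ν →
          NuAsso.IsRegularSubdivision (P.asso h) (P.support h) ∧
          NuAsso.IsAssociahedron (NuAsso.nonInitialNorth ν) (P.support h)) := by
    rintro P _ rfl h hh
    obtain ⟨h1, h2, h3⟩ := main P h hh
    rw [P.nonInitialNorth_path]
    exact ⟨h1.trans h2, fun hν => h3 (h2.2 hν)⟩
  refine ⟨main, fun ν => ⟨NuAsso.exists_path_eq ν, fun P hP => paths P ν hP⟩, ?_⟩
  intro m n hm hn P hP h hh
  obtain ⟨h1, h2⟩ := paths P _ hP h hh
  have hν := NuAsso.not_hasNonInitialNN_fussCatalanPath hm n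
  rw [NuAsso.nonInitialNorth_fussCatalanPath hm hn] at h2
  exact ⟨h1.2 hν, h2 hν⟩
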